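/- Let $x_1,\dots,x_r\in\mathbb P^2_{\mathbb C}$ be $r\ge 10$ distinct points (for instance, points in very general position), and let $X$ be the blow-up of $\mathbb P^2$ at them. Let $N(X)$ be the space of real numerical classes of divisors (equivalently, of curves) on $X$, with its intersection product; it has the basis formed by the class $L_0$ of the pull-back of a line and the classes $E_1,\dots,E_r$ of the exceptional curves, with $L_0^2=1$, $L_0\cdot E_i=0$, $E_i\cdot E_j=-\delta_{ij}$, and the proper transform of an integral plane curve $D$ has class $\deg(D)L_0-\sum_i\operatorname{mult}_{x_i}(D)E_i$. Let $K=-3L_0+\sum_iE_i$ be the canonical class, and let $\overline{NE}(X)\subset N(X)$ be the Mori cone, that is, the closure of the convex cone spanned by the classes of integral curves on $X$. Let $$Q=\{\alpha\in N(X)\mid \alpha^2\ge 0,\ \alpha\cdot h\ge 0 \text{ for some ample class } h\}.$$ For $\alpha\in N(X)$ put $R(\alpha)=\mathbb R_{\ge0}\,\alpha$, and for a cone $V$ put $V|_{\alpha^{\ge0}}=\{\beta\in V\mid \alpha\cdot\beta\ge0\}$ and $\partial V=V\smallsetminus V^\circ$, where $V^\circ$ is the relative interior. A $(-1)$-ray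 is an isolated extremal ray of $\overline{NE}(X)$ spanned by an integral curve $C$ with $K\cdot C<0$. The $(-1)$-Curves Conjecture for $X$ is the assertion that $\overline{NE}(X)=Q+\sum R_i$, where the sum runs over all extremal rays $R_i$ of $\overline{NE}(X)$ on which $K$ is negative (away from $0$). Let $s=\sqrt{r-1}-3$, and let $L$ be the class of the pull-back of a line under an arbitrary birational morphism $X\to\mathbb P^2$. Then every $(-1)$-ray is contained in $Q+R(K-sL)$, and if the $(-1)$-Curves Conjecture holds for $X$, then $$\overline{NE}(X)|_{(K-sL)^{\ge0}}=Q|_{(K-sL)^{\ge0}}.$$ Moreover: (a) If $r=10$, then every $(-1)$-ray is contained in $\partial(Q+R(K))$, and if the $(-1)$-Curves Conjecture holds for $X$, then $\overline{NE}(X)|_{K^{\ge0}}=Q|_{K^{\ge0}}$. (b) If $r>10$, then every $(-1)$-ray meets $Q+R(K)$ only in $0$, and (unconditionally) $Q|_{K^{\ge0}}\subsetneq\overline{NE}(X)|_{K^{\ge0}}$. -/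

import Mathlib

open scoped Pointwise NNReal LinearAlgebra.Projectivization

noncomputable section

namespace BlowUpPlane

/-! ### Plane curves and multiplicities -/

/-- The complex projective plane. -/
abbrev Plane : Type := ℙ ℂ (Fin 3 → ℂ)

/-- Forms in the homogeneous coordinates of the plane are homogeneous elements of this ring. -/
abbrev PolyRing : Type := MvPolynomial (Fin 3) ℂ

/-- The Taylor expansion `F (v + X)` of `F` at the point `v` of the affine cone over the plane. -/
def taylorAt (v : Fin 3 → ℂ) (F : PolyRing) : PolyRing :=
  MvPolynomial.aeval (fun i => MvPolynomial.X i + MvPolynomial.C (v i)) F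

/-- The form `F` vanishes to order at least `k` at the point `p`. -/
def VanishesToOrder (p : Plane) (k : ℕ) (F : PolyRing) : Prop :=
  ∀ n < k, MvPolynomial.homogeneousComponent n (taylorAt p.rep F) = 0

/-- The multiplicity at `p` of a nonzero form `F`: the order of its Taylor expansion at `p`. -/
def multAt (p : Plane) (F : PolyRing) : ℕ :=
  sInf {n | MvPolynomial.homogeneousComponent n (taylorAt p.rep F) ≠ 0}

/-- An integral plane curve, given by an irreducible form. -/
structure PlaneCurve where
  form : PolyRing
  degree : ℕ
  isHomogeneous : form.IsHomogeneous degree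
  irreducible : Irreducible form

/-! ### The Néron–Severi space of the blow-up

`X` is the blow-up of the plane at `r` distinct points `x 0, …, x (r - 1)`, `L` is the pull-back
of a line and `E i` is the exceptional curve over `x i`. The space `N(X)` of real numerical classes
has the basis `L, E 0, …, E (r - 1)`, with `L² = 1`, `L · E i = 0`, `E i · E j = - δ_ij`. -/

/-- `N(X)`: the pair `(a, b)` is the class `a L + ∑ i, b i E i`. -/
abbrev NS (r : ℕ) : Type := ℝ × (Fin r → ℝ)

/-- The intersection product on `N(X)`. -/
def inter {r : ℕ} (α β : NS r) : ℝ := α.1 * β.1 - ∑ i, α.2 i * β.2 i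

/-- The canonical class `K = -3 L + ∑ i, E i`. -/
def canonicalClass (r : ℕ) : NS r := (-3, fun _ => 1)

/-- The integral curves on `X`: the exceptional curves and the proper transforms of the integral
plane curves. -/
inductive IntegralCurve (r : ℕ) : Type
  | exceptional (i : Fin r) : IntegralCurve r
  | properTransform (D : PlaneCurve) : IntegralCurve r

/-- The numerical class of an integral curve: `E i` for an exceptional curve, and
`deg(D) L - ∑ i, mult_{x i}(D) E i` for the proper transform of `D`. -/
def IntegralCurve.cls {r : ℕ} (x : Fin r → Plane) : IntegralCurve r → NS r
  | .exceptional i => (0, Pi.single i 1)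
  | .properTransform D => (D.degree, fun i => -(multAt (x i) D.form : ℝ))

/-! ### Cones in `N(X)` -/

/-- `R(α) = ℝ_{≥ 0} α`. -/
def ray {r : ℕ} (α : NS r) : Set (NS r) := {β | ∃ t : ℝ, 0 ≤ t ∧ β = t • α}

/-- The half-space `α^{≥ 0}`. -/
def nonnegHalfSpace {r : ℕ} (α : NS r) : Set (NS r) := {β | 0 ≤ inter α β}

/-- The boundary `∂V = V ∖ V°` of a closed cone, where `V°` is the relative interior. -/
def coneBoundary {r : ℕ} (V : Set (NS r)) : Set (NS r) := V \ intrinsicInterior ℝ V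

/-- The Mori cone: the closure of the convex cone spanned by the classes of integral curves. -/
def moriCone {r : ℕ} (x : Fin r → Plane) : Set (NS r) :=
  closure (Submodule.span ℝ≥0 (Set.range (IntegralCurve.cls x)) : Set (NS r))

/-- Ample real classes, described by Kleiman's criterion. -/
def IsAmple {r : ℕ} (x : Fin r → Plane) (h : NS r) : Prop :=
  ∀ γ ∈ moriCone x, γ ≠ 0 → 0 < inter h γ

/-- The quadric cone `Q`: classes with `α² ≥ 0` and `α · h ≥ 0` for some ample class `h`. -/
def quadricCone {r : ℕ} (x : Fin r → Plane) : Set (NS r) :=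
  {α | 0 ≤ inter α α ∧ ∃ h, IsAmple x h ∧ 0 ≤ inter α h}

/-- `R` is an extremal ray of the cone `V`. -/
def IsExtremalRay {r : ℕ} (V R : Set (NS r)) : Prop :=
  (∃ α, α ≠ 0 ∧ R = ray α) ∧ R ⊆ V ∧ ∀ β ∈ V, ∀ γ ∈ V, β + γ ∈ R → β ∈ R ∧ γ ∈ R

/-- `R` is isolated among the extremal rays of `V`: some generator of `R` has a neighbourhood
that meets no other extremal ray of `V`. -/
def IsIsolatedExtremalRay {r : ℕ} (V R : Set (NS r)) : Prop :=
  IsExtremalRay V R ∧ ∃ α ∈ R, α ≠ 0 ∧ ∃ U : Set (NS r), IsOpen U ∧ α ∈ U ∧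
    ∀ R', IsExtremalRay V R' → (R' ∩ U).Nonempty → R' = R

/-- The `(-1)`-rays: isolated extremal rays of the Mori cone that are spanned by an integral
curve `C` with `K · C < 0`. -/
def IsMinusOneRay {r : ℕ} (x : Fin r → Plane) (R : Set (NS r)) : Prop :=
  IsIsolatedExtremalRay (moriCone x) R ∧
    ∃ C : IntegralCurve r, R = ray (C.cls x) ∧ inter (canonicalClass r) (C.cls x) < 0

/-- The `K`-negative extremal rays of the Mori cone. -/
def IsKNegativeExtremalRay {r : ℕ} (x : Fin r → Plane) (R : Set (NS r)) : Prop :=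
  IsExtremalRay (moriCone x) R ∧ ∀ α ∈ R, α ≠ 0 → inter (canonicalClass r) α < 0

/-- The assertion of the `(-1)`-Curves Conjecture for the blow-up at the points `x i`: the Mori
cone is `Q + ∑ R_i`, where the `R_i` are the `K`-negative extremal rays of the Mori cone. -/
def MinusOneCurvesConjecture {r : ℕ} (x : Fin r → Plane) : Prop :=
  moriCone x = quadricCone x +
    (Submodule.span ℝ≥0 (⋃₀ {R | IsKNegativeExtremalRay x R}) : Set (NS r))

/-! ### Reductions to the plane -/

/-- `F = (F 0 : F 1 : F 2)` induces a birational morphism `X → ℙ²` under which the pull-back of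
a line has class `d L - ∑ i, m i E i`. That is: the `F j` are sections of the line bundle
`d L - ∑ i, m i E i` (forms of degree `d` that vanish to order at least `m i` at `x i`), these
sections have no common zero on `X`, and the rational map `F` of the plane has a rational
inverse `G`. A point of `X` is either a point of the plane other than the `x i`, or a tangent
direction at some `x i`, that is, a vector `w` not proportional to a representative of `x i`, up to
scaling and up to that representative; in the direction `w` the section given by a form takes the
value at `w` of the part of degree `m i` of the Taylor expansion of the form at `x i`. -/
structure IsReduction {r : ℕ} (x : Fin r → Plane) (d : ℕ) (m : Fin r → ℕ)
    (F : Fin 3 → PolyRing) : Prop where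
  homogeneous : ∀ j, (F j).IsHomogeneous d
  vanishing : ∀ i j, VanishesToOrder (x i) (m i) (F j)
  noBasePoint : ∀ p : Plane, (∀ i, p ≠ x i) → ∃ j, MvPolynomial.eval p.rep (F j) ≠ 0
  noBaseDirection : ∀ i, ∀ w : Fin 3 → ℂ, LinearIndependent ℂ ![(x i).rep, w] →
    ∃ j, MvPolynomial.eval w
      (MvPolynomial.homogeneousComponent (m i) (taylorAt (x i).rep (F j))) ≠ 0
  birational : ∃ (e : ℕ) (G : Fin 3 → PolyRing) (H H' : PolyRing),
    (∀ j, (G j).IsHomogeneous e) ∧ H ≠ 0 ∧ H' ≠ 0 ∧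
    (∀ j, MvPolynomial.aeval F (G j) = H * MvPolynomial.X j) ∧
    (∀ j, MvPolynomial.aeval G (F j) = H' * MvPolynomial.X j)

/-- `L` is the class of the pull-back of a line under some reduction `X → ℙ²`. -/
def IsLinePullback {r : ℕ} (x : Fin r → Plane) (L : NS r) : Prop :=
  ∃ (d : ℕ) (m : Fin r → ℕ) (F : Fin 3 → PolyRing), IsReduction x d m F ∧
    L = ((d : ℝ), fun i => -(m i : ℝ))

end BlowUpPlane

end

/-!
By Riemann–Roch, that is, by counting the conditions imposed by fat points, every class of
nonnegative square and degree is a limit of effective classes up to scaling, so `Q` lies in the Mori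
cone. Its rays have too many tangent directions in the Mori cone to be isolated. Hence, by
adjunction, a `(-1)`-ray is spanned by the class `c` of a curve with `c² = K · c = -1`.
Let `M` be `K` or `K - s L`; since `L² = 1`, `K · L = -3` and `L · c ≥ 0`, we have `M · c ≤ -1`. If
`M² = -1`, then `(c - M)² ≥ 0`, so `c = (c - M) + M` lies in `Q + R(M)`; when `M · c = -1`, the
functional `(c - M) · _` is nonnegative on this cone and vanishes on `c`. If `K² < -1`, then no
`t c - u K` with `t > 0` and `u ≥ 0` has nonnegative square.

For the class `L` of a reduction to the plane, comparing dimensions of linear systems under the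
inverse Cremona map gives `L² ≤ 1` and `K · L ≥ -3`. Bézout's inequality gives `L² ≥ 1`, and
`K · L ≤ -3` holds because `X` has no canonical sections, as the Jacobian of the inverse shows.
-/

noncomputable section

namespace BlowUpPlane

open MvPolynomial

/-! ### The order of a polynomial at the origin -/

section LowestTerms

variable {σ R : Type*} [CommRing R]

lemma mem_pow_idealOfVars_iff_homogeneousComponent {k : ℕ} {f : MvPolynomial σ R} :
    f ∈ idealOfVars σ R ^ k ↔ ∀ n < k, homogeneousComponent n f = 0 := by
  classical
  rw [mem_pow_idealOfVars_iff']
  refine ⟨fun h n hn => ?_, fun h a ha => ?_⟩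
  · ext a
    rw [coeff_homogeneousComponent, coeff_zero, ite_eq_right_iff]
    exact fun ha => h a (ha ▸ hn)
  · simpa [coeff_homogeneousComponent] using congrArg (coeff a) (h _ ha)

lemma mem_pow_idealOfVars_of_isHomogeneous {k : ℕ} {f : MvPolynomial σ R}
    (hf : f.IsHomogeneous k) : f ∈ idealOfVars σ R ^ k :=
  mem_pow_idealOfVars_iff_homogeneousComponent.2 fun n hn => by
    rw [homogeneousComponent_of_mem hf, if_neg hn.ne]

lemma sub_homogeneousComponent_mem_pow_idealOfVars {k : ℕ} {f : MvPolynomial σ R}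
    (hf : f ∈ idealOfVars σ R ^ k) : f - homogeneousComponent k f ∈ idealOfVars σ R ^ (k + 1) := by
  rw [mem_pow_idealOfVars_iff_homogeneousComponent] at *
  intro n hn
  rw [map_sub, homogeneousComponent_of_mem (homogeneousComponent_mem k f)]
  rcases (Nat.lt_succ_iff.1 hn).lt_or_eq with hlt | rfl
  · rw [hf n hlt, if_neg hlt.ne, sub_zero]
  · rw [if_pos rfl, sub_self]

lemma homogeneousComponent_mul_of_mem_pow_idealOfVars {k l : ℕ} {f g : MvPolynomial σ R}
    (hf : f ∈ idealOfVars σ R ^ k) (hg : g ∈ idealOfVars σ R ^ l) :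
    homogeneousComponent (k + l) (f * g) =
      homogeneousComponent k f * homogeneousComponent l g := by
  have hf' := sub_homogeneousComponent_mem_pow_idealOfVars hf
  have hg' := sub_homogeneousComponent_mem_pow_idealOfVars hg
  set f₀ := homogeneousComponent k f
  set g₀ := homogeneousComponent l g
  have hrest : (f - f₀) * g + f₀ * (g - g₀) ∈ idealOfVars σ R ^ (k + l + 1) := by
    refine add_mem ?_ ?_
    · rw [show k + l + 1 = k + 1 + l by ring, pow_add]
      exact Ideal.mul_mem_mul hf' hg
    · rw [add_assoc, pow_add]
      exact Ideal.mul_mem_mul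
        (mem_pow_idealOfVars_of_isHomogeneous (homogeneousComponent_isHomogeneous k f)) hg'
  rw [show f * g = f₀ * g₀ + ((f - f₀) * g + f₀ * (g - g₀)) by ring, map_add,
    mem_pow_idealOfVars_iff_homogeneousComponent.1 hrest _ (Nat.lt_succ_self _), add_zero]
  exact homogeneousComponent_eq_self
    ((homogeneousComponent_isHomogeneous k f).mul (homogeneousComponent_isHomogeneous l g))

lemma exists_mem_pow_idealOfVars {f : MvPolynomial σ R} (hf : f ≠ 0) :
    ∃ k, f ∈ idealOfVars σ R ^ k ∧ homogeneousComponent k f ≠ 0 := by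
  classical
  have h : ∃ k, homogeneousComponent k f ≠ 0 := by
    by_contra! h
    exact hf ((sum_homogeneousComponent f).symm.trans (Finset.sum_eq_zero fun i _ => h i))
  exact ⟨Nat.find h, mem_pow_idealOfVars_iff_homogeneousComponent.2
    fun n hn => by simpa using Nat.find_min h hn, Nat.find_spec h⟩

lemma isHomogeneous_of_mem_pow_idealOfVars {k : ℕ} {f : MvPolynomial σ R}
    (hf : f ∈ idealOfVars σ R ^ k) (hd : f.totalDegree ≤ k) : f.IsHomogeneous k := by
  intro a ha
  rw [show Finsupp.weight 1 a = a.degree from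
    (DFunLike.congr_fun Finsupp.degree_eq_weight_one a).symm]
  exact ((le_totalDegree (mem_support_iff.2 ha)).trans hd).antisymm
    ((mem_pow_idealOfVars_iff k f).1 hf a (mem_support_iff.2 ha))

variable [IsDomain R]

lemma isHomogeneous_of_mul {n : ℕ} {f g : MvPolynomial σ R} (h : (f * g).IsHomogeneous n)
    (hfg : f * g ≠ 0) : ∃ k l, k + l = n ∧ f.IsHomogeneous k ∧ g.IsHomogeneous l := by
  have hf := left_ne_zero_of_mul hfg
  have hg := right_ne_zero_of_mul hfg
  obtain ⟨k, hk, hk₀⟩ := exists_mem_pow_idealOfVars hf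
  obtain ⟨l, hl, hl₀⟩ := exists_mem_pow_idealOfVars hg
  have hkd : k ≤ f.totalDegree := not_lt.1 fun hc => hk₀ (homogeneousComponent_eq_zero _ _ hc)
  have hld : l ≤ g.totalDegree := not_lt.1 fun hc => hl₀ (homogeneousComponent_eq_zero _ _ hc)
  have hlow := homogeneousComponent_mul_of_mem_pow_idealOfVars hk hl
  have hkl : k + l = n := by
    by_contra hne
    rw [homogeneousComponent_of_mem h, if_neg hne] at hlow
    exact mul_ne_zero hk₀ hl₀ hlow.symm
  have hdeg := totalDegree_mul_of_isDomain hf hg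
  rw [h.totalDegree hfg] at hdeg
  exact ⟨k, l, hkl, isHomogeneous_of_mem_pow_idealOfVars hk (by lia),
    isHomogeneous_of_mem_pow_idealOfVars hl (by lia)⟩

lemma isHomogeneous_of_mul_right {n d : ℕ} {f g : MvPolynomial σ R}
    (h : (f * g).IsHomogeneous (d + n)) (hf : f.IsHomogeneous d) (hf₀ : f ≠ 0) :
    g.IsHomogeneous n := by
  by_cases hg : g = 0
  · exact hg ▸ isHomogeneous_zero _ _ _
  obtain ⟨k, l, hkl, hk, hl⟩ := isHomogeneous_of_mul h (mul_ne_zero hf₀ hg)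
  obtain rfl := hk.inj_right hf hf₀
  exact (show l = n by lia) ▸ hl

end LowestTerms

section Forms

variable {σ R A : Type*} [CommRing R] [CommRing A] [Algebra R A]

lemma aeval_mul_of_isHomogeneous {P : MvPolynomial σ R} {D : ℕ} (hP : P.IsHomogeneous D) (a : A)
    (y : σ → A) : aeval (fun i => a * y i) P = a ^ D * aeval y P := by
  rw [aeval_def, aeval_def, eval₂_eq, eval₂_eq, Finset.mul_sum]
  refine Finset.sum_congr rfl fun s hs => ?_
  have hd : D = ∑ i ∈ s.support, s i := hP.degree_eq_sum_deg_support hs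
  simp only [mul_pow, Finset.prod_mul_distrib, Finset.prod_pow_eq_pow_sum]
  rw [← hd]
  ring

lemma eval_smul_of_isHomogeneous {P : MvPolynomial σ R} {D : ℕ} (hP : P.IsHomogeneous D) (a : R)
    (w : σ → R) : eval (a • w) P = a ^ D * eval w P := by
  simpa only [coe_aeval_eq_eval, ← smul_eq_mul] using! aeval_mul_of_isHomogeneous hP a w

end Forms

/-! ### Taylor expansions and multiplicities -/

/-- The Taylor expansion `taylorAt v` as an algebra homomorphism. -/
def taylorHom (v : Fin 3 → ℂ) : PolyRing →ₐ[ℂ] PolyRing :=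
  aeval fun i => X i + C (v i)

lemma aeval_taylorHom {A : Type*} [CommRing A] [Algebra ℂ A] (v : Fin 3 → ℂ) (y : Fin 3 → A)
    (P : PolyRing) : aeval y (taylorHom v P) = aeval (fun i => y i + algebraMap ℂ A (v i)) P := by
  have h : (aeval y).comp (taylorHom v) = aeval fun i => y i + algebraMap ℂ A (v i) := by
    ext i
    simp [taylorHom]
  exact DFunLike.congr_fun h P

lemma taylorHom_injective (v : Fin 3 → ℂ) : Function.Injective (taylorHom v) := by
  refine Function.LeftInverse.injective (g := taylorHom (-v)) fun F => ?_
  rw [taylorHom, aeval_taylorHom]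
  simp

lemma totalDegree_taylorHom_le {v : Fin 3 → ℂ} {F : PolyRing} {d : ℕ} (hF : F.IsHomogeneous d) :
    (taylorHom v F).totalDegree ≤ d := by
  rw [taylorHom, aeval_def, eval₂_eq]
  refine totalDegree_finsetSum_le fun s hs => ?_
  have hlin : ∀ i, (X i + C (v i) : PolyRing).totalDegree ≤ 1 := fun i =>
    (totalDegree_add _ _).trans (by simp)
  calc _ ≤ (algebraMap ℂ PolyRing (coeff s F)).totalDegree +
        (∏ i ∈ s.support, (X i + C (v i) : PolyRing) ^ s i).totalDegree := totalDegree_mul _ _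
    _ ≤ ∑ i ∈ s.support, ((X i + C (v i) : PolyRing) ^ s i).totalDegree := by
        rw [algebraMap_eq, totalDegree_C, zero_add]
        exact totalDegree_finsetProd _ _
    _ ≤ ∑ i ∈ s.support, s i := Finset.sum_le_sum fun i _ =>
        (totalDegree_pow _ _).trans ((Nat.mul_le_mul_left _ (hlin i)).trans_eq (mul_one _))
    _ = d := (hF.degree_eq_sum_deg_support hs).symm

/-- The forms whose Taylor expansion at `p` has order at least `k`: on forms, this is the ideal of
the fat point `k p`. -/
def fatPointIdeal (p : Plane) (k : ℕ) : Ideal PolyRing :=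
  (idealOfVars (Fin 3) ℂ ^ k).comap (taylorHom p.rep)

lemma vanishesToOrder_iff_mem_fatPointIdeal {p : Plane} {k : ℕ} {F : PolyRing} :
    VanishesToOrder p k F ↔ F ∈ fatPointIdeal p k :=
  mem_pow_idealOfVars_iff_homogeneousComponent.symm

lemma VanishesToOrder.mono {p : Plane} {k l : ℕ} {F : PolyRing} (hF : VanishesToOrder p k F)
    (h : l ≤ k) : VanishesToOrder p l F := fun n hn => hF n (hn.trans_le h)

lemma VanishesToOrder.mul {p : Plane} {k l : ℕ} {F G : PolyRing} (hF : VanishesToOrder p k F)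
    (hG : VanishesToOrder p l G) : VanishesToOrder p (k + l) (F * G) := by
  rw [vanishesToOrder_iff_mem_fatPointIdeal, fatPointIdeal, Ideal.mem_comap] at *
  rw [map_mul, pow_add]
  exact Ideal.mul_mem_mul hF hG

lemma VanishesToOrder.mul_left {p : Plane} {k : ℕ} {F : PolyRing} (hF : VanishesToOrder p k F)
    (G : PolyRing) : VanishesToOrder p k (G * F) :=
  vanishesToOrder_iff_mem_fatPointIdeal.2
    (Ideal.mul_mem_left _ G (vanishesToOrder_iff_mem_fatPointIdeal.1 hF))

lemma VanishesToOrder.pow {p : Plane} {k : ℕ} {F : PolyRing} (hF : VanishesToOrder p k F) (n : ℕ) :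
    VanishesToOrder p (k * n) (F ^ n) := by
  rw [vanishesToOrder_iff_mem_fatPointIdeal, fatPointIdeal, Ideal.mem_comap] at *
  rw [map_pow, pow_mul]
  exact Ideal.pow_mem_pow hF n

lemma homogeneousComponent_zero_taylorHom (v : Fin 3 → ℂ) (F : PolyRing) :
    homogeneousComponent 0 (taylorHom v F) = C (eval v F) := by
  have h : constantCoeff (taylorHom v F) = eval v F := by
    simpa [constantCoeff_eq, coe_aeval_eq_eval] using aeval_taylorHom v (0 : Fin 3 → ℂ) F
  rw [homogeneousComponent_zero, ← constantCoeff_eq, h]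

lemma vanishesToOrder_one_iff {p : Plane} {F : PolyRing} :
    VanishesToOrder p 1 F ↔ eval p.rep F = 0 := by
  have h₀ : homogeneousComponent 0 (taylorAt p.rep F) = C (eval p.rep F) :=
    homogeneousComponent_zero_taylorHom _ _
  simp only [VanishesToOrder, Nat.lt_one_iff, forall_eq, h₀, C_eq_zero]

lemma multAt_spec (p : Plane) {F : PolyRing} (hF : F ≠ 0) :
    VanishesToOrder p (multAt p F) F ∧
      homogeneousComponent (multAt p F) (taylorHom p.rep F) ≠ 0 := by
  obtain ⟨k, -, hk⟩ := exists_mem_pow_idealOfVars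
    ((map_ne_zero_iff _ (taylorHom_injective p.rep)).2 hF)
  have hmem : multAt p F ∈ {n | homogeneousComponent n (taylorAt p.rep F) ≠ 0} :=
    Nat.sInf_mem ⟨k, hk⟩
  exact ⟨fun n hn => not_not.1 (Nat.notMem_of_lt_sInf hn), hmem⟩

lemma vanishesToOrder_iff_le_multAt {p : Plane} {k : ℕ} {F : PolyRing} (hF : F ≠ 0) :
    VanishesToOrder p k F ↔ k ≤ multAt p F :=
  ⟨fun h => not_lt.1 fun hlt => (multAt_spec p hF).2 (h _ hlt),
    fun h => (multAt_spec p hF).1.mono h⟩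

lemma vanishesToOrder_multAt (p : Plane) {F : PolyRing} (hF : F ≠ 0) :
    VanishesToOrder p (multAt p F) F := (multAt_spec p hF).1

lemma multAt_mul (p : Plane) {F G : PolyRing} (hF : F ≠ 0) (hG : G ≠ 0) :
    multAt p (F * G) = multAt p F + multAt p G := by
  obtain ⟨hFv, hF₀⟩ := multAt_spec p hF
  obtain ⟨hGv, hG₀⟩ := multAt_spec p hG
  refine le_antisymm (Nat.sInf_le ?_)
    ((vanishesToOrder_iff_le_multAt (mul_ne_zero hF hG)).1 (hFv.mul hGv))
  change homogeneousComponent _ (taylorHom p.rep (F * G)) ≠ 0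
  rw [map_mul, homogeneousComponent_mul_of_mem_pow_idealOfVars
    (vanishesToOrder_iff_mem_fatPointIdeal.1 hFv) (vanishesToOrder_iff_mem_fatPointIdeal.1 hGv)]
  exact mul_ne_zero hF₀ hG₀

lemma multAt_le_of_isHomogeneous (p : Plane) {F : PolyRing} {d : ℕ} (hF : F ≠ 0)
    (hd : F.IsHomogeneous d) : multAt p F ≤ d := by
  by_contra! hlt
  exact (multAt_spec p hF).2
    (homogeneousComponent_eq_zero _ _ ((totalDegree_taylorHom_le hd).trans_lt hlt))

/-! ### Linear forms and adapted frames -/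

section LinearForms

variable {A : Type*} [CommRing A] [Algebra ℂ A]

/-- The linear form with coefficients `c`. -/
def linForm (c : Fin 3 → ℂ) : PolyRing := ∑ i, C (c i) * X i

lemma linForm_isHomogeneous (c : Fin 3 → ℂ) : (linForm c).IsHomogeneous 1 :=
  IsHomogeneous.sum _ _ _ fun _ _ => isHomogeneous_C_mul_X _ _

lemma eval_linForm (c w : Fin 3 → ℂ) : eval w (linForm c) = c ⬝ᵥ w := by
  simp [linForm, dotProduct]

lemma aeval_linForm (c : Fin 3 → ℂ) (y : Fin 3 → A) :
    aeval y (linForm c) = ∑ i, algebraMap ℂ A (c i) * y i := by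
  simp [linForm]

lemma taylorHom_linForm (c v : Fin 3 → ℂ) :
    taylorHom v (linForm c) = linForm c + C (c ⬝ᵥ v) := by
  simp only [linForm, taylorHom, map_sum, map_mul, algHom_C, aeval_X, algebraMap_eq, dotProduct,
    mul_add, Finset.sum_add_distrib]

lemma vanishesToOrder_one_linForm {p : Plane} {c : Fin 3 → ℂ} (h : c ⬝ᵥ p.rep = 0) :
    VanishesToOrder p 1 (linForm c) := by
  rw [vanishesToOrder_one_iff, eval_linForm, h]

/-- A basis `w` of `ℂ³` with `w 0 = v`, and its dual basis `c`: affine coordinates around the point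
with homogeneous coordinates `v` are `c 1` and `c 2`. -/
structure AdaptedFrame (v : Fin 3 → ℂ) where
  w : Fin 3 → Fin 3 → ℂ
  c : Fin 3 → Fin 3 → ℂ
  w_zero : w 0 = v
  dotProduct_eq : ∀ k l, c k ⬝ᵥ w l = if k = l then 1 else 0

namespace AdaptedFrame

lemma exists_of_ne_zero {v : Fin 3 → ℂ} (hv : v ≠ 0) : Nonempty (AdaptedFrame v) := by
  obtain ⟨i, hi⟩ := Function.ne_iff.1 hv
  have h1 : i + 1 ≠ i := by fin_cases i <;> decide
  have h2 : i + 2 ≠ i := by fin_cases i <;> decide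
  have h12 : i + 1 ≠ i + 2 := by fin_cases i <;> decide
  refine ⟨⟨![v, Pi.single (i + 1) 1, Pi.single (i + 2) 1],
    ![Pi.single i (v i)⁻¹, Pi.single (i + 1) 1 - Pi.single i (v (i + 1) / v i),
      Pi.single (i + 2) 1 - Pi.single i (v (i + 2) / v i)], rfl, fun k l => ?_⟩⟩
  have hi' : v i ≠ 0 := hi
  fin_cases k <;> fin_cases l <;> simp [sub_dotProduct, hi', h1, h2, h12, h12.symm]

variable {v : Fin 3 → ℂ} (f : AdaptedFrame v)

lemma dotProduct_succ (l : Fin 2) : f.c l.succ ⬝ᵥ v = 0 := by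
  simpa [f.w_zero, l.succ_ne_zero] using f.dotProduct_eq l.succ 0

lemma linForm_ne_zero (k : Fin 3) : linForm (f.c k) ≠ 0 := fun h => by
  simpa [h, f.dotProduct_eq] using eval_linForm (f.c k) (f.w k)

lemma eq_sum (y : Fin 3 → A) (j : Fin 3) :
    y j = ∑ k, aeval y (linForm (f.c k)) * algebraMap ℂ A (f.w k j) := by
  have hcw : (Matrix.of f.c) * (Matrix.of f.w).transpose = 1 := by
    ext k l
    exact (f.dotProduct_eq k l).trans (Matrix.one_apply).symm
  have hdual : ∀ i, ∑ k, f.w k j * f.c k i = if j = i then 1 else 0 := fun i =>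
    (congrFun₂ (mul_eq_one_comm.1 hcw :
      (Matrix.of f.w).transpose * Matrix.of f.c = 1) j i).trans Matrix.one_apply
  simp only [aeval_linForm, Finset.sum_mul]
  rw [Finset.sum_comm]
  calc y j = ∑ i, algebraMap ℂ A (if j = i then 1 else 0) * y i := by simp
    _ = _ := Finset.sum_congr rfl fun i _ => by
      rw [← hdual, map_sum, Finset.sum_mul]
      exact Finset.sum_congr rfl fun k _ => by rw [map_mul]; ring

lemma eq_smul_add (u : Fin 3 → ℂ) :
    u = (fun j => ∑ l : Fin 2, (f.c l.succ ⬝ᵥ u) * f.w l.succ j) + (f.c 0 ⬝ᵥ u) • v := by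
  funext j
  have h := f.eq_sum u j
  rw [Fin.sum_univ_succ] at h
  have hc : ∀ c, aeval u (linForm c) = c ⬝ᵥ u := fun c => eval_linForm c u
  simp only [hc, f.w_zero, Algebra.algebraMap_self_apply] at h
  exact h.trans (add_comm _ _)

end AdaptedFrame

lemma exists_dotProduct_separating {p q : Plane} (h : p ≠ q) :
    ∃ c : Fin 3 → ℂ, c ⬝ᵥ p.rep = 0 ∧ c ⬝ᵥ q.rep ≠ 0 := by
  obtain ⟨f⟩ := AdaptedFrame.exists_of_ne_zero p.rep_nonzero
  by_contra! hc
  apply h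
  rw [← p.mk_rep, ← q.mk_rep, eq_comm, Projectivization.mk_eq_mk_iff']
  refine ⟨f.c 0 ⬝ᵥ q.rep, ?_⟩
  have hq := f.eq_smul_add q.rep
  simp only [hc _ (f.dotProduct_succ _), zero_mul, Finset.sum_const_zero] at hq
  exact (hq.trans (zero_add _)).symm

end LinearForms

/-! ### The leading term of a form at a point -/

lemma sum_homogeneousComponent_taylorHom {P : PolyRing} {D : ℕ} (hP : P.IsHomogeneous D)
    (v : Fin 3 → ℂ) :
    ∑ k ∈ Finset.range (D + 1), homogeneousComponent k (taylorHom v P) = taylorHom v P := by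
  conv_rhs => rw [← sum_homogeneousComponent (taylorHom v P)]
  refine (Finset.sum_subset (Finset.range_mono (Nat.succ_le_succ (totalDegree_taylorHom_le hP)))
    fun k _ hk => ?_).symm
  exact homogeneousComponent_eq_zero _ _ (by simpa using hk)

/-- Over the fraction field this is the Taylor expansion at `v` of `P (v + δ / α)`. -/
lemma aeval_mul_add_eq_sum {A : Type*} [CommRing A] [IsDomain A] [Algebra ℂ A] {P : PolyRing}
    {D : ℕ} (hP : P.IsHomogeneous D) (v : Fin 3 → ℂ) {α : A} (hα : α ≠ 0) (δ : Fin 3 → A) :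
    aeval (fun i => α * algebraMap ℂ A (v i) + δ i) P =
      ∑ k ∈ Finset.range (D + 1), α ^ (D - k) *
        aeval δ (homogeneousComponent k (taylorHom v P)) := by
  let K := FractionRing A
  let ι := algebraMap A K
  have hι : ∀ (y : Fin 3 → A) (R : PolyRing), ι (aeval y R) = aeval (fun i => ι (y i)) R :=
    fun y R => (aeval_algebraMap_apply K y R).symm
  have hα' : ι α ≠ 0 := (map_ne_zero_iff _ (IsFractionRing.injective A K)).2 hα
  apply IsFractionRing.injective A K
  calc ι (aeval (fun i => α * algebraMap ℂ A (v i) + δ i) P)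
      = aeval (fun i => ι α * ((ι α)⁻¹ * ι (δ i) + algebraMap ℂ K (v i))) P := by
        rw [hι]
        congr 2
        funext i
        rw [map_add, map_mul, ← IsScalarTower.algebraMap_apply ℂ A K, mul_add,
          mul_inv_cancel_left₀ hα', add_comm]
    _ = ι α ^ D * ∑ k ∈ Finset.range (D + 1),
          (ι α)⁻¹ ^ k * aeval (fun i => ι (δ i)) (homogeneousComponent k (taylorHom v P)) := by
        rw [aeval_mul_of_isHomogeneous hP, ← aeval_taylorHom,
          ← sum_homogeneousComponent_taylorHom hP v, map_sum]
        simp only [aeval_mul_of_isHomogeneous (homogeneousComponent_isHomogeneous _ _),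
          sum_homogeneousComponent_taylorHom hP v]
    _ = _ := by
        rw [map_sum, Finset.mul_sum]
        refine Finset.sum_congr rfl fun k hk => ?_
        have hkD : k ≤ D := Nat.lt_succ_iff.1 (Finset.mem_range.1 hk)
        rw [← mul_assoc, map_mul, map_pow, hι, inv_pow, ← pow_sub₀ _ hα' hkD]

lemma coeff_aeval_line {P : PolyRing} {D k : ℕ} (hP : P.IsHomogeneous D) {p : Plane}
    (hk : VanishesToOrder p k P) (a : ℂ) (u : Fin 3 → ℂ) :
    (aeval (fun i => (1 + Polynomial.C a * Polynomial.X) * algebraMap ℂ (Polynomial ℂ) (p.rep i) +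
      Polynomial.X * algebraMap ℂ (Polynomial ℂ) (u i)) P).coeff k =
      eval u (homogeneousComponent k (taylorHom p.rep P)) := by
  have hα : (1 + Polynomial.C a * Polynomial.X : Polynomial ℂ) ≠ 0 := fun h => by
    simpa using congrArg (Polynomial.eval 0) h
  have hterm : ∀ n, aeval (fun i => Polynomial.X * algebraMap ℂ (Polynomial ℂ) (u i))
      (homogeneousComponent n (taylorHom p.rep P)) =
        Polynomial.X ^ n * Polynomial.C (eval u (homogeneousComponent n (taylorHom p.rep P))) :=
    fun n => by
      rw [aeval_mul_of_isHomogeneous (homogeneousComponent_isHomogeneous _ _)]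
      exact congrArg _ (aeval_algebraMap_apply (Polynomial ℂ) u _)
  rw [aeval_mul_add_eq_sum hP _ hα, Polynomial.finsetSum_coeff]
  simp only [hterm, ← mul_assoc, Polynomial.coeff_mul_C, Polynomial.coeff_mul_X_pow']
  rw [Finset.sum_eq_single k]
  · simp [Polynomial.coeff_zero_eq_eval_zero]
  · intro n _ hnk
    rcases hnk.lt_or_gt with hlt | hlt
    · have hz : homogeneousComponent n (taylorHom p.rep P) = 0 := hk n hlt
      simp [hz]
    · simp [hlt.not_ge]
  · intro hkD
    have hz : homogeneousComponent k (taylorHom p.rep P) = 0 := homogeneousComponent_eq_zero _ _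
      ((totalDegree_taylorHom_le hP).trans_lt (by simpa using hkD))
    simp [hz]

/-- The point `p` is a line through the origin of the affine cone, along which a form has constant
leading term up to scaling. -/
lemma eval_add_smul_homogeneousComponent_taylorHom {P : PolyRing} {D k : ℕ}
    (hP : P.IsHomogeneous D) {p : Plane} (hk : VanishesToOrder p k P) (a : ℂ) (u : Fin 3 → ℂ) :
    eval (u + a • p.rep) (homogeneousComponent k (taylorHom p.rep P)) =
      eval u (homogeneousComponent k (taylorHom p.rep P)) := by
  rw [← coeff_aeval_line hP hk a u, ← coeff_aeval_line hP hk 0 (u + a • p.rep)]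
  have hline : (fun i => (1 + Polynomial.C a * Polynomial.X) *
        algebraMap ℂ (Polynomial ℂ) (p.rep i) + Polynomial.X * algebraMap ℂ (Polynomial ℂ) (u i)) =
      fun i => (1 + Polynomial.C 0 * Polynomial.X) * algebraMap ℂ (Polynomial ℂ) (p.rep i) +
        Polynomial.X * algebraMap ℂ (Polynomial ℂ) ((u + a • p.rep) i) := by
    funext i
    simp only [Pi.add_apply, Pi.smul_apply, smul_eq_mul, map_add, map_mul, map_zero,
      Polynomial.algebraMap_eq]
    ring
  rw [hline]

/-- The term of degree `k` of the Taylor expansion at `p`, in the affine coordinates of a frame. -/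
def affineJet {p : Plane} (f : AdaptedFrame p.rep) (k : ℕ) :
    PolyRing →ₗ[ℂ] MvPolynomial (Fin 2) ℂ :=
  (aeval fun j => ∑ l : Fin 2, C (f.w l.succ j) * X l).toLinearMap ∘ₗ
    homogeneousComponent k ∘ₗ (taylorHom p.rep).toLinearMap

section AffineJet

variable {p : Plane} (f : AdaptedFrame p.rep)

lemma affineJet_apply (k : ℕ) (P : PolyRing) : affineJet f k P =
    aeval (fun j => ∑ l : Fin 2, C (f.w l.succ j) * X l)
      (homogeneousComponent k (taylorHom p.rep P)) := rfl

lemma affineJet_isHomogeneous (k : ℕ) (P : PolyRing) : (affineJet f k P).IsHomogeneous k := by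
  have h := (homogeneousComponent_isHomogeneous k (taylorHom p.rep P)).aeval (n := 1)
    (fun j => ∑ l : Fin 2, C (f.w l.succ j) * X l)
    fun j => IsHomogeneous.sum _ _ _ fun _ _ => isHomogeneous_C_mul_X _ _
  rwa [one_mul] at h

lemma affineJet_eq_zero_iff {P : PolyRing} {D k : ℕ} (hP : P.IsHomogeneous D)
    (hk : VanishesToOrder p k P) : affineJet f k P = 0 ↔ VanishesToOrder p (k + 1) P := by
  refine ⟨fun h n hn => ?_, fun h => ?_⟩
  · rcases (Nat.lt_succ_iff.1 hn).lt_or_eq with hlt | rfl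
    · exact hk n hlt
    apply MvPolynomial.funext
    intro u
    change eval u (homogeneousComponent n (taylorHom p.rep P)) = _
    have heval := congrArg (aeval fun l : Fin 2 => f.c l.succ ⬝ᵥ u) h
    rw [affineJet_apply, comp_aeval_apply, map_zero] at heval
    simp only [map_sum, map_mul, aeval_C, aeval_X, Algebra.algebraMap_self_apply,
      mul_comm (f.w _ _)] at heval
    calc eval u (homogeneousComponent n (taylorHom p.rep P))
        = eval (fun j => ∑ l : Fin 2, (f.c l.succ ⬝ᵥ u) * f.w l.succ j)
            (homogeneousComponent n (taylorHom p.rep P)) := by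
          conv_lhs => rw [f.eq_smul_add u]
          exact eval_add_smul_homogeneousComponent_taylorHom hP hk _ _
      _ = eval u 0 := heval.trans (map_zero _).symm
  · have hz : homogeneousComponent k (taylorHom p.rep P) = 0 := h k (Nat.lt_succ_self k)
    rw [affineJet_apply, hz, map_zero]

lemma taylorHom_aeval_linForm (b : MvPolynomial (Fin 2) ℂ) :
    taylorHom p.rep (aeval (fun l => linForm (f.c l.succ)) b) =
      aeval (fun l => linForm (f.c l.succ)) b := by
  rw [comp_aeval_apply]
  simp only [taylorHom_linForm, f.dotProduct_succ, C_0, add_zero]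

lemma aeval_linForm_isHomogeneous {b : MvPolynomial (Fin 2) ℂ} {k : ℕ} (hb : b.IsHomogeneous k) :
    (aeval (fun l => linForm (f.c l.succ)) b).IsHomogeneous k := by
  have h := hb.aeval (n := 1) (fun l : Fin 2 => linForm (f.c l.succ))
    fun _ => linForm_isHomogeneous _
  rwa [one_mul] at h

lemma vanishesToOrder_aeval_linForm {b : MvPolynomial (Fin 2) ℂ} {k : ℕ}
    (hb : b.IsHomogeneous k) :
    VanishesToOrder p k (aeval (fun l => linForm (f.c l.succ)) b) := by
  rw [vanishesToOrder_iff_mem_fatPointIdeal, fatPointIdeal, Ideal.mem_comap,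
    taylorHom_aeval_linForm]
  exact mem_pow_idealOfVars_of_isHomogeneous (aeval_linForm_isHomogeneous f hb)

lemma affineJet_aeval_linForm_mul {b : MvPolynomial (Fin 2) ℂ} {k : ℕ} (hb : b.IsHomogeneous k)
    (P : PolyRing) : affineJet f k (aeval (fun l => linForm (f.c l.succ)) b * P) =
      eval p.rep P • b := by
  have hbf := aeval_linForm_isHomogeneous f hb
  have hcoord : ∀ l : Fin 2, aeval (fun j => ∑ m : Fin 2, C (f.w m.succ j) * X m)
      (linForm (f.c l.succ)) = (X l : MvPolynomial (Fin 2) ℂ) := fun l => by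
    simp only [aeval_linForm, Finset.mul_sum, algebraMap_eq, ← mul_assoc, ← C_mul]
    rw [Finset.sum_comm]
    simp only [← Finset.sum_mul, ← map_sum]
    change ∑ m : Fin 2, C (f.c l.succ ⬝ᵥ f.w m.succ) * X m = _
    simp [f.dotProduct_eq]
  rw [affineJet_apply, map_mul, taylorHom_aeval_linForm]
  conv_lhs => rw [← add_zero k]
  rw [homogeneousComponent_mul_of_mem_pow_idealOfVars (mem_pow_idealOfVars_of_isHomogeneous hbf)
    (by simp), homogeneousComponent_eq_self hbf, homogeneousComponent_zero_taylorHom, map_mul,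
    comp_aeval_apply]
  simp only [hcoord, aeval_X_left_apply, aeval_C, algebraMap_eq, mul_comm b, smul_eq_C_mul]

end AffineJet

/-! ### Dimensions of spaces of forms with assigned multiplicities -/

lemma finrank_homogeneousSubmodule (σ R : Type*) [Fintype σ] [CommRing R] [Nontrivial R] (n : ℕ) :
    Module.finrank R (homogeneousSubmodule σ R n) = (Fintype.card σ + n - 1).choose n := by
  classical
  rw [homogeneousSubmodule_eq_finsupp_supported]
  refine (Module.finrank_eq_nat_card_basis (basisRestrictSupport R {a | a.degree = n})).trans ?_
  have hset : {a : σ →₀ ℕ | a.degree = n} = (Finset.univ : Finset σ).finsuppAntidiag n := by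
    ext a
    simp [Finsupp.degree_eq_sum]
  rw [hset, Nat.card_eq_card_toFinset, Finset.toFinset_coe,
    Finset.card_finsuppAntidiag_nat_eq_choose, Finset.card_univ]

lemma finrank_homogeneousSubmodule_fin_three (D : ℕ) :
    Module.finrank ℂ (homogeneousSubmodule (Fin 3) ℂ D) = (D + 2).choose 2 := by
  rw [finrank_homogeneousSubmodule, Fintype.card_fin, show 3 + D - 1 = D + 2 by lia,
    ← Nat.choose_symm_add]

lemma finrank_homogeneousSubmodule_fin_two (k : ℕ) :
    Module.finrank ℂ (homogeneousSubmodule (Fin 2) ℂ k) = k + 1 := by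
  rw [finrank_homogeneousSubmodule, Fintype.card_fin, show 2 + k - 1 = k + 1 - 0 by lia,
    Nat.sub_zero, Nat.choose_succ_self_right]

instance {σ : Type*} [Finite σ] (n : ℕ) : FiniteDimensional ℂ (homogeneousSubmodule σ ℂ n) :=
  Module.Finite.of_fg (homogeneousSubmodule_fg σ ℂ n)

section FormsVanishing

variable {ι : Type*} {x : ι → Plane} {D : ℕ} {k : ι → ℕ}

/-- The space of forms of degree `D` that vanish to order at least `k i` at each `x i`: the sections
of the line bundle `D L - ∑ i, k i E i` on the blow-up at the points `x i`. -/
def formsVanishing (x : ι → Plane) (D : ℕ) (k : ι → ℕ) : Submodule ℂ PolyRing :=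
  homogeneousSubmodule (Fin 3) ℂ D ⊓ ⨅ i, (fatPointIdeal (x i) (k i)).restrictScalars ℂ

lemma mem_formsVanishing {P : PolyRing} :
    P ∈ formsVanishing x D k ↔ P.IsHomogeneous D ∧ ∀ i, VanishesToOrder (x i) (k i) P := by
  simp only [formsVanishing, Submodule.mem_inf, mem_homogeneousSubmodule, Submodule.mem_iInf,
    Submodule.restrictScalars_mem, vanishesToOrder_iff_mem_fatPointIdeal]

lemma formsVanishing_zero (x : ι → Plane) (D : ℕ) :
    formsVanishing x D 0 = homogeneousSubmodule (Fin 3) ℂ D := by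
  ext P
  simp [mem_formsVanishing, VanishesToOrder]

instance : FiniteDimensional ℂ (formsVanishing x D k) :=
  Submodule.finiteDimensional_of_le inf_le_left

lemma mul_mem_formsVanishing {P Q : PolyRing} {E : ℕ} {l : ι → ℕ} (hP : P ∈ formsVanishing x D k)
    (hQ : Q ∈ formsVanishing x E l) : P * Q ∈ formsVanishing x (D + E) (k + l) := by
  rw [mem_formsVanishing] at *
  exact ⟨hP.1.mul hQ.1, fun i => (hP.2 i).mul (hQ.2 i)⟩

lemma exists_form_ne_zero_at {s : Finset ι} {p : Plane} (hp : ∀ i ∈ s, x i ≠ p)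
    (hD : ∑ i ∈ s, k i ≤ D) :
    ∃ P : PolyRing, P.IsHomogeneous D ∧ (∀ i ∈ s, VanishesToOrder (x i) (k i) P) ∧
      eval p.rep P ≠ 0 := by
  classical
  have hex : ∀ i, ∃ c : Fin 3 → ℂ, i ∈ s → c ⬝ᵥ (x i).rep = 0 ∧ c ⬝ᵥ p.rep ≠ 0 := fun i => by
    by_cases hi : i ∈ s
    · exact (exists_dotProduct_separating (hp i hi)).imp fun _ hc _ => hc
    · exact ⟨0, fun h => absurd h hi⟩
  choose c hc using hex
  obtain ⟨f⟩ := AdaptedFrame.exists_of_ne_zero p.rep_nonzero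
  have hu : f.c 0 ⬝ᵥ p.rep ≠ 0 := by
    simpa [f.w_zero] using (f.dotProduct_eq 0 0).trans_ne one_ne_zero
  refine ⟨(∏ i ∈ s, linForm (c i) ^ k i) * linForm (f.c 0) ^ (D - ∑ i ∈ s, k i), ?_, ?_, ?_⟩
  · have h1 : (∏ i ∈ s, linForm (c i) ^ k i).IsHomogeneous (∑ i ∈ s, k i) :=
      IsHomogeneous.prod _ _ _ fun i _ => by
        simpa using (linForm_isHomogeneous (c i)).pow (k i)
    have h2 := h1.mul ((linForm_isHomogeneous (f.c 0)).pow (D - ∑ i ∈ s, k i))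
    rwa [one_mul, Nat.add_sub_cancel' hD] at h2
  · intro i hi
    rw [← Finset.prod_erase_mul s _ hi, mul_right_comm]
    have h1 := (vanishesToOrder_one_linForm (hc i hi).1).pow (k i)
    rw [one_mul] at h1
    exact h1.mul_left _
  · simp only [map_mul, map_prod, map_pow, eval_linForm]
    exact mul_ne_zero (Finset.prod_ne_zero_iff.2 fun i hi => pow_ne_zero _ (hc i hi).2)
      (pow_ne_zero _ hu)

lemma mem_formsVanishing_update_succ [DecidableEq ι] {P : PolyRing} {i : ι} :
    P ∈ formsVanishing x D (Function.update k i (k i + 1)) ↔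
      P ∈ formsVanishing x D k ∧ VanishesToOrder (x i) (k i + 1) P := by
  simp only [mem_formsVanishing]
  refine ⟨fun h => ⟨⟨h.1, fun j => (h.2 j).mono ?_⟩, by simpa using h.2 i⟩,
    fun h => ⟨h.1.1, fun j => ?_⟩⟩
  · rcases eq_or_ne j i with rfl | hj <;> simp [*]
  · rcases eq_or_ne j i with rfl | hj
    · simpa using h.2
    · simpa [hj] using h.1.2 j

/-- The leading terms at `x i` of the forms in `formsVanishing x D k`. -/
def leadingTerm (x : ι → Plane) (D : ℕ) (k : ι → ℕ) {i : ι} (f : AdaptedFrame (x i).rep) :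
    formsVanishing x D k →ₗ[ℂ] homogeneousSubmodule (Fin 2) ℂ (k i) :=
  ((affineJet f (k i)).domRestrict _).codRestrict _ fun P => affineJet_isHomogeneous f _ P.1

lemma finrank_range_leadingTerm_add_finrank [DecidableEq ι] {i : ι} (f : AdaptedFrame (x i).rep) :
    Module.finrank ℂ (LinearMap.range (leadingTerm x D k f)) +
      Module.finrank ℂ (formsVanishing x D (Function.update k i (k i + 1))) =
        Module.finrank ℂ (formsVanishing x D k) := by
  have hker : (LinearMap.ker (leadingTerm x D k f)).map (formsVanishing x D k).subtype =
      formsVanishing x D (Function.update k i (k i + 1)) := by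
    ext P
    rw [mem_formsVanishing_update_succ, Submodule.mem_map]
    constructor
    · rintro ⟨⟨P, hP⟩, hPk, rfl⟩
      have hP' := mem_formsVanishing.1 hP
      exact ⟨hP, (affineJet_eq_zero_iff f hP'.1 (hP'.2 i)).1 (congrArg Subtype.val hPk)⟩
    · rintro ⟨hP, hv⟩
      have hP' := mem_formsVanishing.1 hP
      exact ⟨⟨P, hP⟩, Subtype.ext ((affineJet_eq_zero_iff f hP'.1 (hP'.2 i)).2 hv), rfl⟩
  rw [← hker, Submodule.finrank_map_subtype_eq]
  exact LinearMap.finrank_range_add_finrank_ker _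

lemma induction_update_succ [Finite ι] {motive : (ι → ℕ) → Prop} (k : ι → ℕ) (zero : motive 0)
    (update : ∀ [DecidableEq ι] k i, motive k → motive (Function.update k i (k i + 1))) :
    motive k := by
  classical
  have := Fintype.ofFinite ι
  induction hn : ∑ i, k i generalizing k with
  | zero => simpa [show k = 0 from funext (by simpa using hn)] using zero
  | succ n ih =>
    obtain ⟨i, -, hi⟩ := Finset.exists_ne_zero_of_sum_ne_zero (hn.trans_ne n.succ_ne_zero)
    have h := update (Function.update k i (k i - 1)) i (ih _ ?_)
    · simpa [Nat.sub_add_cancel (Nat.one_le_iff_ne_zero.2 hi)] using h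
    · rw [Finset.sum_update_of_mem (Finset.mem_univ i)]
      have hsum := Finset.add_sum_erase Finset.univ k (Finset.mem_univ i)
      rw [Finset.sdiff_singleton_eq_erase]
      lia

variable [Fintype ι]

lemma leadingTerm_surjective (hx : Function.Injective x) (hD : ∑ i, k i ≤ D) {i : ι}
    (f : AdaptedFrame (x i).rep) : Function.Surjective (leadingTerm x D k f) := by
  classical
  have hsum := Finset.add_sum_erase Finset.univ k (Finset.mem_univ i)
  obtain ⟨P, hPh, hPv, hP₀⟩ := exists_form_ne_zero_at (x := x) (k := k) (D := D - k i)
    (s := Finset.univ.erase i) (p := x i) (fun j hj => hx.ne (Finset.ne_of_mem_erase hj)) (by lia)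
  intro b
  have hb : (b : MvPolynomial (Fin 2) ℂ).IsHomogeneous (k i) := b.2
  let Q := aeval (fun l => linForm (f.c l.succ)) (b : MvPolynomial (Fin 2) ℂ) * P
  have hQ : Q ∈ formsVanishing x D k := by
    refine mem_formsVanishing.2 ⟨?_, fun j => ?_⟩
    · have h := (aeval_linForm_isHomogeneous f hb).mul hPh
      rwa [Nat.add_sub_cancel' (by lia)] at h
    · rcases eq_or_ne j i with rfl | hj
      · simp only [Q, mul_comm _ P]
        exact (vanishesToOrder_aeval_linForm f hb).mul_left P
      · exact (hPv j (Finset.mem_erase.2 ⟨hj, Finset.mem_univ j⟩)).mul_left _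
  refine ⟨(eval (x i).rep P)⁻¹ • ⟨Q, hQ⟩, Subtype.ext ?_⟩
  rw [map_smul]
  change _ • affineJet f (k i) Q = _
  rw [affineJet_aeval_linForm_mul f hb, inv_smul_smul₀ hP₀]

lemma sum_comp_update_succ [DecidableEq ι] (φ : ℕ → ℕ) (k : ι → ℕ) (i : ι) :
    ∑ j, φ (Function.update k i (k i + 1) j) + φ (k i) = ∑ j, φ (k j) + φ (k i + 1) := by
  have hsum := Finset.add_sum_erase Finset.univ (fun j => φ (k j)) (Finset.mem_univ i)
  simp only [Function.apply_update (fun _ => φ), Finset.sum_update_of_mem (Finset.mem_univ i),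
    Finset.sdiff_singleton_eq_erase]
  lia

lemma choose_two_succ (n : ℕ) : (n + 1).choose 2 = n.choose 2 + n := by
  rw [Nat.choose_succ_succ', Nat.choose_one_right, add_comm]

variable (x D k) in
lemma le_finrank_formsVanishing :
    (D + 2).choose 2 ≤
      Module.finrank ℂ (formsVanishing x D k) + ∑ i, (k i + 1).choose 2 := by
  induction k using induction_update_succ with
  | zero =>
    rw [formsVanishing_zero, finrank_homogeneousSubmodule_fin_three]
    exact Nat.le_add_right _ _
  | update k i ih =>
    obtain ⟨f⟩ := AdaptedFrame.exists_of_ne_zero (x i).rep_nonzero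
    have hrank := finrank_range_leadingTerm_add_finrank (D := D) (k := k) f
    have hrange := Submodule.finrank_le (LinearMap.range (leadingTerm x D k f))
    rw [finrank_homogeneousSubmodule_fin_two] at hrange
    have hsum := sum_comp_update_succ (fun n => (n + 1).choose 2) k i
    have hchoose := choose_two_succ (k i + 1)
    lia

lemma finrank_formsVanishing (hx : Function.Injective x) (hD : ∑ i, k i ≤ D) :
    Module.finrank ℂ (formsVanishing x D k) + ∑ i, (k i + 1).choose 2 = (D + 2).choose 2 := by
  induction k using induction_update_succ with
  | zero =>
    rw [formsVanishing_zero, finrank_homogeneousSubmodule_fin_three]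
    simp
  | update k i ih =>
    have hk := sum_comp_update_succ id k i
    simp only [id_eq] at hk
    obtain ⟨f⟩ := AdaptedFrame.exists_of_ne_zero (x i).rep_nonzero
    have hrank := finrank_range_leadingTerm_add_finrank (D := D) (k := k) f
    rw [LinearMap.range_eq_top.2 (leadingTerm_surjective hx (by lia) f), finrank_top,
      finrank_homogeneousSubmodule_fin_two] at hrank
    have hsum := sum_comp_update_succ (fun n => (n + 1).choose 2) k i
    have hchoose := choose_two_succ (k i + 1)
    have := ih (by lia)
    lia

end FormsVanishing

/-! ### Points on plane curves -/

lemma exists_mem_zeroLocus_eval_ne_zero {σ K : Type*} [Finite σ] [Field K] [IsAlgClosed K]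
    {I : Ideal (MvPolynomial σ K)} [I.IsPrime] {H : MvPolynomial σ K} (hH : H ∉ I) :
    ∃ y ∈ zeroLocus K I, eval y H ≠ 0 := by
  by_contra! h
  have hmem : H ∈ vanishingIdeal K (zeroLocus K I) := h
  rw [IsPrime.vanishingIdeal_zeroLocus] at hmem
  exact hH hmem

lemma eval_aeval {σ τ R : Type*} [CommSemiring R] (y : τ → R) (G : σ → MvPolynomial τ R)
    (f : MvPolynomial σ R) : eval y (aeval G f) = eval (fun j => eval y (G j)) f := by
  simpa only [aeval_eq_eval] using comp_aeval_apply G (aeval y) f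

lemma mk_ne_of_dotProduct_ne_zero {p : Plane} {c w : Fin 3 → ℂ} (hp : c ⬝ᵥ p.rep = 0)
    (hw : c ⬝ᵥ w ≠ 0) (hw₀ : w ≠ 0) : Projectivization.mk ℂ w hw₀ ≠ p := by
  rintro rfl
  obtain ⟨a, ha⟩ := Projectivization.exists_smul_eq_mk_rep ℂ w hw₀
  rw [← ha, Units.smul_def, dotProduct_smul, smul_eq_zero] at hp
  exact hp.elim a.ne_zero hw

-- Apply the Nullstellensatz to the product of `H`, a coordinate `G j` and the `c p`.
lemma exists_mem_zeroLocus_mk_notMem {I : Ideal PolyRing} [hI : I.IsPrime] {H : PolyRing}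
    (hH : H ∉ I) {G : Fin 3 → PolyRing} (hG : ∃ j, G j ∉ I) {S : Finset Plane}
    (hS : ∀ p ∈ S, ∃ c, c ⬝ᵥ p.rep = 0 ∧ aeval G (linForm c) ∉ I) :
    ∃ y ∈ zeroLocus ℂ I, eval y H ≠ 0 ∧ ∃ hy : (fun j => eval y (G j)) ≠ 0,
      Projectivization.mk ℂ _ hy ∉ S := by
  obtain ⟨j, hj⟩ := hG
  choose! c hc hcI using hS
  have hprod : ∏ p ∈ S, aeval G (linForm (c p)) ∉ I := fun h => by
    obtain ⟨p, hp, hpI⟩ := (hI.prod_mem_iff).1 h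
    exact hcI p hp hpI
  obtain ⟨y, hyI, hy⟩ := exists_mem_zeroLocus_eval_ne_zero
    (hI.mul_notMem hH (hI.mul_notMem hj hprod))
  simp only [map_mul, map_prod, mul_ne_zero_iff, Finset.prod_ne_zero_iff] at hy
  refine ⟨y, hyI, hy.1, fun h => hy.2.1 (congrFun h j), fun hmem => ?_⟩
  refine mk_ne_of_dotProduct_ne_zero (hc _ hmem) ?_ _ rfl
  simpa only [eval_aeval, eval_linForm] using hy.2.2 _ hmem

lemma irreducible_linForm {c : Fin 3 → ℂ} (hc : linForm c ≠ 0) : Irreducible (linForm c) := by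
  refine irreducible_of_totalDegree_eq_one ((linForm_isHomogeneous c).totalDegree hc) fun a ha => ?_
  obtain ⟨s, hs⟩ := ne_zero_iff.1 hc
  exact isUnit_iff_ne_zero.2 (ne_zero_of_dvd_ne_zero hs (ha s))

lemma exists_linForm_not_dvd {f : PolyRing} (hf : ¬ IsUnit f) (p : Plane) :
    ∃ c : Fin 3 → ℂ, c ⬝ᵥ p.rep = 0 ∧ ¬ f ∣ linForm c := by
  obtain ⟨F⟩ := AdaptedFrame.exists_of_ne_zero p.rep_nonzero
  by_contra! h
  have hc : linForm (F.c 1) ≠ 0 := fun hz => by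
    simpa [eval_linForm, F.dotProduct_eq] using congrArg (eval (F.w 1)) hz
  have hassoc := ((irreducible_linForm hc).dvd_iff.1 (h _ (F.dotProduct_succ 0))).resolve_left hf
  obtain ⟨u, hu⟩ : linForm (F.c 1) ∣ linForm (F.c 2) := hassoc.dvd.trans (h _ (F.dotProduct_succ 1))
  simpa [eval_linForm, F.dotProduct_eq] using congrArg (eval (F.w 2)) hu

lemma eval_rep_mk_eq_zero_iff {F : PolyRing} {d : ℕ} (hF : F.IsHomogeneous d) {w : Fin 3 → ℂ}
    (hw : w ≠ 0) : eval (Projectivization.mk ℂ w hw).rep F = 0 ↔ eval w F = 0 := by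
  obtain ⟨a, ha⟩ := Projectivization.exists_smul_eq_mk_rep ℂ w hw
  rw [← ha, Units.smul_def, eval_smul_of_isHomogeneous hF]
  simp

lemma exists_point_of_isPrime {I : Ideal PolyRing} [I.IsPrime] {H : PolyRing} {e : ℕ}
    (hH : H.IsHomogeneous e) (hHI : H ∉ I)
    (hI : ∀ p : Plane, ∃ c, c ⬝ᵥ p.rep = 0 ∧ linForm c ∉ I) (S : Finset Plane) :
    ∃ p : Plane, p ∉ S ∧ eval p.rep H ≠ 0 ∧
      ∀ f ∈ I, ∀ d, f.IsHomogeneous d → eval p.rep f = 0 := by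
  have hX : ∃ j, (X j : PolyRing) ∉ I := by
    obtain ⟨c, -, hc⟩ := hI (Projectivization.mk ℂ (Pi.single 0 1) (by simp))
    contrapose! hc
    exact I.sum_mem fun j _ => I.mul_mem_left _ (hc j)
  obtain ⟨y, hyI, hyH, hy₀, hyS⟩ := exists_mem_zeroLocus_mk_notMem hHI hX (S := S)
    fun p _ => by simpa only [aeval_X_left_apply] using hI p
  simp only [eval_X] at hy₀ hyS
  exact ⟨_, hyS, fun h => hyH ((eval_rep_mk_eq_zero_iff hH hy₀).1 h),
    fun f hf d hfd => (eval_rep_mk_eq_zero_iff hfd hy₀).2 (hyI f hf)⟩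

lemma exists_point {f H : PolyRing} {d e : ℕ} (hf : Irreducible f) (hfd : f.IsHomogeneous d)
    (hH : H.IsHomogeneous e) (hfH : ¬ f ∣ H) (S : Finset Plane) :
    ∃ p : Plane, p ∉ S ∧ eval p.rep f = 0 ∧ eval p.rep H ≠ 0 := by
  have : (Ideal.span {f}).IsPrime := (Ideal.span_singleton_prime hf.ne_zero).2 hf.prime
  obtain ⟨p, hp, hpH, hpf⟩ := exists_point_of_isPrime (I := Ideal.span {f}) hH
    (by rwa [Ideal.mem_span_singleton]) (fun p => by
      simpa only [Ideal.mem_span_singleton] using exists_linForm_not_dvd hf.not_isUnit p) S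
  exact ⟨p, hp, hpf f (Ideal.mem_span_singleton_self f) d hfd, hpH⟩

lemma exists_point_eval_ne_zero {H : PolyRing} {e : ℕ} (hH : H.IsHomogeneous e) (hH₀ : H ≠ 0)
    (S : Finset Plane) : ∃ p : Plane, p ∉ S ∧ eval p.rep H ≠ 0 := by
  obtain ⟨p, hp, hpH, -⟩ := exists_point_of_isPrime (I := ⊥) hH hH₀ (fun p => by
    obtain ⟨c, hc, hcX⟩ := exists_linForm_not_dvd not_isUnit_zero p
    exact ⟨c, hc, fun h => hcX (zero_dvd_iff.2 h)⟩) S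
  exact ⟨p, hp, hpH⟩

lemma exists_points {f : PolyRing} {d : ℕ} (hf : Irreducible f) (hfd : f.IsHomogeneous d)
    (S : Finset Plane) (n : ℕ) :
    ∃ T : Finset Plane, T.card = n ∧ Disjoint T S ∧ ∀ p ∈ T, eval p.rep f = 0 := by
  classical
  induction n with
  | zero => exact ⟨∅, by simp⟩
  | succ n ih =>
    obtain ⟨T, hT, hTS, hTf⟩ := ih
    obtain ⟨p, hp, hpf, -⟩ := exists_point hf hfd (isHomogeneous_one (Fin 3) ℂ)
      (fun h => hf.not_isUnit (isUnit_of_dvd_one h)) (T ∪ S)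
    rw [Finset.mem_union, not_or] at hp
    exact ⟨insert p T, by rw [Finset.card_insert_of_notMem hp.1, hT],
      Finset.disjoint_insert_left.2 ⟨hp.2, hTS⟩, Finset.forall_mem_insert _ _ _ |>.2 ⟨hpf, hTf⟩⟩

/-! ### Bézout's inequality and the genus -/

lemma finrank_map_mulLeft {F : PolyRing} (hF : F ≠ 0) (V : Submodule ℂ PolyRing) :
    Module.finrank ℂ (V.map (LinearMap.mulLeft ℂ F)) = Module.finrank ℂ V :=
  (Submodule.equivMapOfInjective _ (mul_right_injective₀ hF) V).finrank_eq.symm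

lemma finrank_add_finrank_le_of_isRelPrime {F G : PolyRing} {d s : ℕ} (hF : F.IsHomogeneous d)
    (hF₀ : F ≠ 0) (hG₀ : G ≠ 0) (hFG : IsRelPrime F G) {V₁ V₂ W : Submodule ℂ PolyRing}
    [FiniteDimensional ℂ W] (hV₂ : V₂ ≤ homogeneousSubmodule (Fin 3) ℂ (d + s))
    (h₁ : V₁.map (LinearMap.mulLeft ℂ F) ≤ W) (h₂ : V₂.map (LinearMap.mulLeft ℂ G) ≤ W) :
    Module.finrank ℂ V₁ + Module.finrank ℂ V₂ ≤ Module.finrank ℂ W + (s + 2).choose 2 := by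
  have hinf : V₁.map (LinearMap.mulLeft ℂ F) ⊓ V₂.map (LinearMap.mulLeft ℂ G) ≤
      (homogeneousSubmodule (Fin 3) ℂ s).map (LinearMap.mulLeft ℂ (G * F)) := by
    rintro _ ⟨⟨A, -, rfl⟩, B, hB, hAB⟩
    have hFB : F ∣ B := hFG.dvd_of_dvd_mul_left ⟨A, hAB⟩
    obtain ⟨Z, rfl⟩ := hFB
    exact ⟨Z, isHomogeneous_of_mul_right (hV₂ hB) hF hF₀, by simpa [mul_assoc] using hAB⟩
  have := Submodule.finiteDimensional_of_le h₁
  have := Submodule.finiteDimensional_of_le h₂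
  rw [← finrank_map_mulLeft hF₀ V₁, ← finrank_map_mulLeft hG₀ V₂,
    ← finrank_homogeneousSubmodule_fin_three,
    ← finrank_map_mulLeft (mul_ne_zero hG₀ hF₀) (homogeneousSubmodule (Fin 3) ℂ s),
    ← Submodule.finrank_sup_add_finrank_inf_eq]
  exact add_le_add (Submodule.finrank_mono (sup_le h₁ h₂)) (Submodule.finrank_mono hinf)

section Bezout

variable {ι : Type*} [Fintype ι] {x : ι → Plane}

lemma sum_mul_le_mul_of_isRelPrime (hx : Function.Injective x) {F G : PolyRing} {d e : ℕ}
    {m k : ι → ℕ} (hF : F ∈ formsVanishing x d m) (hG : G ∈ formsVanishing x e k) (hF₀ : F ≠ 0)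
    (hG₀ : G ≠ 0) (hFG : IsRelPrime F G) : ∑ i, m i * k i ≤ d * e := by
  set s := ∑ i, (m + k) i
  have hle := finrank_add_finrank_le_of_isRelPrime (s := s) (V₁ := formsVanishing x (e + s) k)
    (V₂ := formsVanishing x (d + s) m) (W := formsVanishing x (d + (e + s)) (m + k))
    (mem_formsVanishing.1 hF).1 hF₀ hG₀ hFG inf_le_left
    (Submodule.map_le_iff_le_comap.2 fun A hA => mul_mem_formsVanishing hF hA)
    (Submodule.map_le_iff_le_comap.2 fun B hB => by
      have h := mul_mem_formsVanishing hG hB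
      rwa [add_comm k m, add_left_comm] at h)
  have h₁ := le_finrank_formsVanishing x (e + s) k
  have h₂ := le_finrank_formsVanishing x (d + s) m
  have h₃ := finrank_formsVanishing hx (D := d + (e + s)) (k := m + k) (by lia)
  have hchoose : ∑ i, ((m + k) i + 1).choose 2 =
      ∑ i, (m i + 1).choose 2 + ∑ i, (k i + 1).choose 2 + ∑ i, m i * k i := by
    simp only [← Finset.sum_add_distrib, ← Nat.cast_inj (R := ℚ)]
    push_cast [Nat.cast_choose_two]
    refine Finset.sum_congr rfl fun i _ => ?_
    simp only [Pi.add_apply]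
    push_cast
    ring
  have hkey : (e + s + 2).choose 2 + (d + s + 2).choose 2 + ∑ i, m i * k i ≤
      (d + (e + s) + 2).choose 2 + (s + 2).choose 2 := by lia
  rw [← Nat.cast_le (α := ℚ)] at hkey ⊢
  push_cast [Nat.cast_choose_two] at hkey ⊢
  linarith

lemma exists_mem_formsVanishing_not_dvd {F : PolyRing} {d s : ℕ} {k : ι → ℕ}
    (hF : F.IsHomogeneous d) (hF₀ : F ≠ 0)
    (h : (s + 2).choose 2 + ∑ i, (k i + 1).choose 2 < (d + s + 2).choose 2) :
    ∃ G ∈ formsVanishing x (d + s) k, ¬ F ∣ G := by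
  by_contra! hdvd
  have hle : formsVanishing x (d + s) k ≤
      (homogeneousSubmodule (Fin 3) ℂ s).map (LinearMap.mulLeft ℂ F) := fun G hG => by
    obtain ⟨Z, rfl⟩ := hdvd G hG
    exact ⟨Z, isHomogeneous_of_mul_right (mem_formsVanishing.1 hG).1 hF hF₀, rfl⟩
  have hfin := Submodule.finrank_mono hle
  rw [finrank_map_mulLeft hF₀, finrank_homogeneousSubmodule_fin_three] at hfin
  have := le_finrank_formsVanishing x (d + s) k
  lia

lemma pos_of_irreducible_of_isHomogeneous {F : PolyRing} {d : ℕ} (hF : Irreducible F)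
    (hFd : F.IsHomogeneous d) : 0 < d := by
  rw [← hFd.totalDegree hF.ne_zero, Nat.pos_iff_ne_zero]
  exact fun h => hF.not_isUnit (isUnit_iff_totalDegree_of_isReduced.2
    ⟨isUnit_iff_ne_zero.2 fun h0 => hF.ne_zero ((totalDegree_eq_zero_iff_eq_C.1 h).trans
      (by rw [h0, C_0])), h⟩)

-- Let a form not divisible by `F` pass through `n` further points of `F`, and apply Bézout.
lemma sum_mul_add_le_of_choose_two_lt (hx : Function.Injective x) {F : PolyRing} {d s n : ℕ}
    {m k : ι → ℕ} (hF : Irreducible F) (hFm : F ∈ formsVanishing x d m)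
    (h : (s + 2).choose 2 + ∑ i, (k i + 1).choose 2 + n < (d + s + 2).choose 2) :
    ∑ i, m i * k i + n ≤ d * (d + s) := by
  classical
  have hFd := (mem_formsVanishing.1 hFm).1
  obtain ⟨T, hT, hTS, hTF⟩ := exists_points hF hFd (Finset.univ.image x) n
  have hx' : Function.Injective (Sum.elim x ((↑) : T → Plane)) :=
    hx.sumElim Subtype.val_injective fun i p h => Finset.disjoint_left.1 hTS p.2
      (h ▸ Finset.mem_image_of_mem x (Finset.mem_univ i))
  have hF' : F ∈ formsVanishing (Sum.elim x ((↑) : T → Plane)) d (Sum.elim m 1) :=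
    mem_formsVanishing.2 ⟨hFd, Sum.forall.2 ⟨(mem_formsVanishing.1 hFm).2,
      fun p => vanishesToOrder_one_iff.2 (hTF p p.2)⟩⟩
  obtain ⟨G, hG, hFG⟩ := exists_mem_formsVanishing_not_dvd (s := s)
    (x := Sum.elim x ((↑) : T → Plane)) (k := Sum.elim k 1) hFd hF.ne_zero (by
      simpa [hT, add_assoc] using h)
  simpa [hT] using sum_mul_le_mul_of_isRelPrime hx' hF' hG hF.ne_zero
    (fun h => hFG (h ▸ dvd_zero F)) (hF.isRelPrime_iff_not_dvd.2 hFG)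

lemma sub_one_add_one_choose_two (n : ℕ) : (n - 1 + 1).choose 2 = n.choose 2 := by
  cases n <;> rfl

-- The forms with multiplicity one less than `F` at each point are the adjoints of `F`.
lemma sum_choose_two_multAt_le (hx : Function.Injective x) {F : PolyRing} {d : ℕ}
    (hF : Irreducible F) (hFd : F.IsHomogeneous d) :
    ∑ i, (multAt (x i) F).choose 2 ≤ (d - 1).choose 2 := by
  set m : ι → ℕ := fun i => multAt (x i) F
  set τ := ∑ i, (m i).choose 2 with hτ
  have hmk : ∑ i, m i * (m i - 1) = 2 * τ := by
    rw [hτ, Finset.mul_sum]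
    exact Finset.sum_congr rfl fun i _ => by
      rw [Nat.choose_two_right, Nat.mul_div_cancel' (Nat.even_mul_pred_self _).two_dvd]
  obtain ⟨c, rfl⟩ : ∃ c, d = c + 1 :=
    ⟨d - 1, (Nat.sub_add_cancel (pos_of_irreducible_of_isHomogeneous hF hFd)).symm⟩
  obtain ⟨n, hn⟩ : ∃ n, (c + 1 + τ + 2).choose 2 = (τ + 2).choose 2 + τ + n + 1 := by
    refine Nat.exists_eq_add_of_lt (lt_of_lt_of_le ?_
      (Nat.choose_le_choose 2 (show τ + 3 ≤ c + 1 + τ + 2 by lia)))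
    rw [Nat.choose_succ_succ' (τ + 2) 1, Nat.choose_one_right]
    lia
  have hbezout := sum_mul_add_le_of_choose_two_lt hx (s := τ) (n := n) (k := fun i => m i - 1) hF
    (mem_formsVanishing.2 ⟨hFd, fun i => vanishesToOrder_multAt (x i) hF.ne_zero⟩) (by
      simp only [sub_one_add_one_choose_two, ← hτ, hn]
      exact Nat.lt_succ_self _)
  rw [hmk] at hbezout
  rw [← Nat.cast_inj (R := ℚ)] at hn
  rw [← Nat.cast_le (α := ℚ)] at hbezout ⊢
  push_cast [Nat.cast_choose_two] at hn hbezout ⊢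
  linarith

end Bezout

/-! ### Rational inverses -/

lemma exists_isHomogeneous_of_mul_X {f : PolyRing} {n : ℕ} {j : Fin 3} (hf : f ≠ 0)
    (h : (f * X j).IsHomogeneous n) : ∃ k, n = k + 1 ∧ f.IsHomogeneous k := by
  obtain ⟨k, l, rfl, hk, hl⟩ := isHomogeneous_of_mul h (mul_ne_zero hf (X_ne_zero j))
  obtain rfl := hl.inj_right (isHomogeneous_X ℂ j) (X_ne_zero j)
  exact ⟨k, rfl, hk⟩

lemma dvd_of_dvd_mul_X {f g : PolyRing} (h : ∀ j, f ∣ g * X j) : f ∣ g := by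
  obtain ⟨a, ha⟩ := h 0
  obtain ⟨b, hb⟩ := h 1
  rcases eq_or_ne f 0 with rfl | hf
  · rw [zero_mul, mul_eq_zero, or_iff_left (X_ne_zero 0)] at ha
    exact ha ▸ dvd_rfl
  have hab : a * X 1 = X 0 * b := mul_left_cancel₀ hf (by
    rw [← mul_assoc, ← ha, mul_left_comm, ← hb]
    ring)
  obtain ⟨c, rfl⟩ :=
    ((X_prime (i := (0 : Fin 3))).dvd_or_dvd ⟨b, hab⟩).resolve_right (by simp [X_dvd_X])
  exact ⟨c, mul_right_cancel₀ (X_ne_zero 0) (by rw [ha]; ring)⟩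

/-- The forms `G` of degree `e` define a rational inverse of the rational self-map of the plane
defined by `F`: both composites are the identity, up to the common factors `H` and `H'`. -/
structure IsRationalInverse (F G : Fin 3 → PolyRing) (e : ℕ) (H H' : PolyRing) : Prop where
  isHomogeneous : ∀ j, (G j).IsHomogeneous e
  left_ne_zero : H ≠ 0
  right_ne_zero : H' ≠ 0
  aeval_left : ∀ j, aeval F (G j) = H * X j
  aeval_right : ∀ j, aeval G (F j) = H' * X j

namespace IsRationalInverse

variable {F G : Fin 3 → PolyRing} {d e : ℕ} {H H' : PolyRing}

protected lemma symm (h : IsRationalInverse F G e H H') (hF : ∀ j, (F j).IsHomogeneous d) :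
    IsRationalInverse G F d H' H :=
  ⟨hF, h.right_ne_zero, h.left_ne_zero, h.aeval_right, h.aeval_left⟩

lemma aeval_aeval (h : IsRationalInverse F G e H H') {s : PolyRing} {n : ℕ}
    (hs : s.IsHomogeneous n) : aeval F (aeval G s) = H ^ n * s := by
  rw [comp_aeval_apply, funext h.aeval_left, aeval_mul_of_isHomogeneous hs, aeval_X_left_apply]

lemma aeval_ne_zero (h : IsRationalInverse F G e H H') {s : PolyRing} {n : ℕ}
    (hs : s.IsHomogeneous n) (hs₀ : s ≠ 0) : aeval G s ≠ 0 := fun h0 => by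
  have := h.aeval_aeval hs
  rw [h0, map_zero] at this
  exact mul_ne_zero (pow_ne_zero n h.left_ne_zero) hs₀ this.symm

lemma exists_isHomogeneous_left (h : IsRationalInverse F G e H H')
    (hF : ∀ j, (F j).IsHomogeneous d) : ∃ k, d * e = k + 1 ∧ H.IsHomogeneous k := by
  refine exists_isHomogeneous_of_mul_X (j := 0) h.left_ne_zero ?_
  rw [← h.aeval_left]
  exact (h.isHomogeneous 0).aeval F hF

end IsRationalInverse

lemma exists_primitive_isRationalInverse {F G : Fin 3 → PolyRing} {d e : ℕ} {H H' : PolyRing}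
    (hF : ∀ j, (F j).IsHomogeneous d) (h : IsRationalInverse F G e H H') :
    ∃ e' G' K K', IsRationalInverse F G' e' K K' ∧ ∀ P, Irreducible P → ∃ j, ¬ P ∣ G' j := by
  induction e using Nat.strong_induction_on generalizing G H H' with
  | _ e ih =>
  by_cases hprim : ∀ P, Irreducible P → ∃ j, ¬ P ∣ G j
  · exact ⟨e, G, H, H', h, hprim⟩
  push Not at hprim
  obtain ⟨P, hP, hPG⟩ := hprim
  choose G₁ hG₁ using hPG
  have hG₀ : G 0 ≠ 0 := fun h0 => mul_ne_zero h.left_ne_zero (X_ne_zero 0)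
    (by rw [← h.aeval_left, h0, map_zero])
  obtain ⟨k, n, rfl, hPk, -⟩ := isHomogeneous_of_mul (hG₁ 0 ▸ h.isHomogeneous 0) (hG₁ 0 ▸ hG₀)
  have hk := pos_of_irreducible_of_isHomogeneous hP hPk
  obtain ⟨K, hK⟩ : aeval F P ∣ H := dvd_of_dvd_mul_X fun j => ⟨aeval F (G₁ j), by
    rw [← h.aeval_left, hG₁, map_mul]⟩
  obtain ⟨K', hK'⟩ : P ^ d ∣ H' := dvd_of_dvd_mul_X fun j => ⟨aeval G₁ (F j), by
    rw [← h.aeval_right, funext hG₁, aeval_mul_of_isHomogeneous (hF j)]⟩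
  have hFP := left_ne_zero_of_mul (hK ▸ h.left_ne_zero)
  have hPd := left_ne_zero_of_mul (hK' ▸ h.right_ne_zero)
  refine ih n (by lia) ⟨fun j => ?_, right_ne_zero_of_mul (hK ▸ h.left_ne_zero),
    right_ne_zero_of_mul (hK' ▸ h.right_ne_zero), fun j => mul_left_cancel₀ hFP ?_,
    fun j => mul_left_cancel₀ hPd ?_⟩ (G := G₁) (H := K) (H' := K')
  · exact isHomogeneous_of_mul_right (hG₁ j ▸ h.isHomogeneous j) hPk hP.ne_zero
  · rw [← map_mul, ← hG₁, h.aeval_left, hK, mul_assoc]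
  · rw [← aeval_mul_of_isHomogeneous (hF j), ← funext hG₁, h.aeval_right, hK', mul_assoc]

/-! ### Curves contracted by a rational map -/

lemma exists_eq_pow_mul_and_exists_not_dvd {κ R : Type*} [CommMonoid R] {p : R} {a : κ → R}
    (h : ∃ l, FiniteMultiplicity p (a l)) :
    ∃ (ν : ℕ) (b : κ → R), (∀ l, a l = p ^ ν * b l) ∧ ∃ l, ¬ p ∣ b l := by
  classical
  have hex : ∃ n, ∃ l, ¬ p ^ (n + 1) ∣ a l := by
    obtain ⟨l, n, hn⟩ := h
    exact ⟨n, l, hn⟩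
  have hdvd : ∀ l, p ^ Nat.find hex ∣ a l := by
    rcases hν : Nat.find hex with _ | ν
    · simp
    · have hmin := Nat.find_min hex (hν ▸ Nat.lt_succ_self ν : ν < Nat.find hex)
      push Not at hmin
      exact hmin
  choose b hb using hdvd
  obtain ⟨l, hl⟩ := Nat.find_spec hex
  refine ⟨Nat.find hex, b, hb, l, fun hbl => hl ?_⟩
  rw [hb l, pow_succ]
  exact mul_dvd_mul_left _ hbl

-- The Taylor expansion of `s` at `p` starts in degree `k`.
lemma pow_succ_dvd_aeval_sub {s : PolyRing} {D k : ℕ} (hs : s.IsHomogeneous D) {p : Plane}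
    (hk : VanishesToOrder p k s) {α : PolyRing} (hα : α ≠ 0) (π : PolyRing)
    (η : Fin 3 → PolyRing) :
    π ^ (k + 1) ∣ aeval (fun l => α * C (p.rep l) + π * η l) s -
      π ^ k * (α ^ (D - k) * aeval η (homogeneousComponent k (taylorHom p.rep s))) := by
  have hterm : ∀ n, aeval (fun l => π * η l) (homogeneousComponent n (taylorHom p.rep s)) =
      π ^ n * aeval η (homogeneousComponent n (taylorHom p.rep s)) := fun n =>
    aeval_mul_of_isHomogeneous (homogeneousComponent_isHomogeneous n _) π η
  have hexp := aeval_mul_add_eq_sum hs p.rep hα (fun l => π * η l)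
  simp only [algebraMap_eq, hterm] at hexp
  have hlt : ∀ n < k, homogeneousComponent n (taylorHom p.rep s) = 0 := hk
  rw [hexp]
  rcases le_or_gt k D with hkD | hkD
  · rw [← Finset.add_sum_erase _ _ (Finset.mem_range.2 (Nat.lt_succ_of_le hkD)),
      mul_left_comm (π ^ k), add_sub_cancel_left]
    refine Finset.dvd_sum fun n hn => Dvd.dvd.mul_left ?_ _
    rcases (Finset.ne_of_mem_erase hn).lt_or_gt with h | h
    · simp [hlt n h]
    · exact Dvd.dvd.mul_right (pow_dvd_pow π h) _
  · rw [homogeneousComponent_eq_zero _ _ ((totalDegree_taylorHom_le hs).trans_lt hkD), map_zero,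
      mul_zero, mul_zero, sub_zero]
    refine Finset.dvd_sum fun n hn => ?_
    simp [hlt n ((Finset.mem_range_succ_iff.1 hn).trans_lt hkD)]

/-- Modulo `P ^ ν`, the rational map defined by `G` is constant with value `p`; for `ν ≠ 0` it
contracts the curve `P = 0` to `p`. -/
def ContractsTo (G : Fin 3 → PolyRing) (P : PolyRing) (p : Plane) (ν : ℕ) : Prop :=
  ∃ (α : PolyRing) (η : Fin 3 → PolyRing), α ≠ 0 ∧ ∀ l, G l = α * C (p.rep l) + P ^ ν * η l

lemma ContractsTo.pow_dvd_aeval {G : Fin 3 → PolyRing} {P : PolyRing} {p : Plane} {ν : ℕ}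
    (h : ContractsTo G P p ν) {s : PolyRing} {D k : ℕ} (hs : s.IsHomogeneous D)
    (hk : VanishesToOrder p k s) : P ^ (ν * k) ∣ aeval G s := by
  obtain ⟨α, η, hα, hG⟩ := h
  have hdvd := (pow_dvd_pow (P ^ ν) k.le_succ).trans (pow_succ_dvd_aeval_sub hs hk hα (P ^ ν) η)
  rw [pow_mul, funext hG]
  exact (dvd_sub_left (dvd_mul_right _ _)).1 hdvd

section Reductions

variable {r d : ℕ} {x : Fin r → Plane} {m : Fin r → ℕ} {F G : Fin 3 → PolyRing} {P : PolyRing}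

namespace IsReduction

lemma exists_forall_dvd_aeval_linForm (hF : IsReduction x d m F) (hP : Irreducible P)
    (hPF : ∀ j, P ∣ aeval G (F j)) (hPG : ∃ j, ¬ P ∣ G j) :
    ∃ i, ∀ c : Fin 3 → ℂ, c ⬝ᵥ (x i).rep = 0 → P ∣ aeval G (linForm c) := by
  classical
  by_contra! h
  have : (Ideal.span {P}).IsPrime := (Ideal.span_singleton_prime hP.ne_zero).2 hP.prime
  obtain ⟨y, hyP, -, hy₀, hyx⟩ := exists_mem_zeroLocus_mk_notMem (I := Ideal.span {P}) (G := G)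
    (Ideal.one_notMem _) (by simpa only [Ideal.mem_span_singleton] using hPG)
    (S := Finset.univ.image x) (by simpa [Ideal.mem_span_singleton] using h)
  obtain ⟨j, hj⟩ := hF.noBasePoint (Projectivization.mk ℂ _ hy₀) fun i hi =>
    hyx (hi ▸ Finset.mem_image_of_mem x (Finset.mem_univ i))
  rw [Ne, eval_rep_mk_eq_zero_iff (hF.homogeneous j)] at hj
  have hmem := hyP _ (Ideal.mem_span_singleton.2 (hPF j))
  exact hj (eval_aeval y G (F j) ▸ hmem)

lemma exists_not_pow_succ_dvd_aeval (hF : IsReduction x d m F) (hP : Irreducible P) {i : Fin r}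
    {α : PolyRing} {η : Fin 3 → PolyRing} (hα : ¬ P ∣ α) {c : Fin 3 → ℂ}
    (hc : c ⬝ᵥ (x i).rep = 0) (hη : ¬ P ∣ aeval η (linForm c)) (ν : ℕ) (hν : 0 < ν) :
    ∃ j, ¬ P ^ (ν * m i + 1) ∣ aeval (fun l => α * C ((x i).rep l) + P ^ ν * η l) (F j) := by
  by_contra! h
  have hα₀ : α ≠ 0 := fun h0 => hα (h0 ▸ dvd_zero P)
  have hjet : ∀ j, P ∣ aeval η (homogeneousComponent (m i) (taylorHom (x i).rep (F j))) :=
      fun j => by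
    have hdvd := (pow_dvd_pow P (show ν * m i + 1 ≤ ν * (m i + 1) by lia)).trans
      (pow_mul P ν (m i + 1) ▸ pow_succ_dvd_aeval_sub (hF.homogeneous j) (hF.vanishing i j) hα₀
        (P ^ ν) η)
    rw [dvd_sub_right (h j), ← pow_mul, pow_succ, mul_dvd_mul_iff_left
      (pow_ne_zero _ hP.ne_zero)] at hdvd
    exact (hP.prime.dvd_or_dvd hdvd).resolve_left fun h => hα (hP.prime.dvd_of_dvd_pow h)
  have : (Ideal.span {P}).IsPrime := (Ideal.span_singleton_prime hP.ne_zero).2 hP.prime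
  obtain ⟨y, hyP, hy⟩ := exists_mem_zeroLocus_eval_ne_zero (I := Ideal.span {P})
    (by rwa [Ideal.mem_span_singleton])
  rw [eval_aeval, eval_linForm] at hy
  obtain ⟨j, hj⟩ := hF.noBaseDirection i (fun l => eval y (η l))
    ((LinearIndependent.pair_iff' (x i).rep_nonzero).2 fun a ha => hy (by
      rw [← ha, dotProduct_smul, hc, smul_zero]))
  have hmem := hyP _ (Ideal.mem_span_singleton.2 (hjet j))
  exact hj (eval_aeval y η _ ▸ hmem)

end IsReduction

-- Divide the coordinates of `G` that vanish at `p` by the largest possible power of `P`.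
lemma exists_eq_mul_add_pow_mul {p : Plane} (hP : Irreducible P) (hPG : ∃ j, ¬ P ∣ G j)
    (hG : ∀ c, linForm c ≠ 0 → aeval G (linForm c) ≠ 0)
    (hdvd : ∀ c : Fin 3 → ℂ, c ⬝ᵥ p.rep = 0 → P ∣ aeval G (linForm c)) :
    ∃ (α : PolyRing) (η : Fin 3 → PolyRing) (ν : ℕ) (c : Fin 3 → ℂ), ¬ P ∣ α ∧ 0 < ν ∧
      c ⬝ᵥ p.rep = 0 ∧ ¬ P ∣ aeval η (linForm c) ∧ ∀ l, G l = α * C (p.rep l) + P ^ ν * η l := by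
  obtain ⟨f⟩ := AdaptedFrame.exists_of_ne_zero p.rep_nonzero
  have hsum : ∀ j, G j = aeval G (linForm (f.c 0)) * C (p.rep j) +
      ∑ l : Fin 2, aeval G (linForm (f.c l.succ)) * C (f.w l.succ j) := fun j => by
    simpa only [Fin.sum_univ_succ (n := 2), f.w_zero, algebraMap_eq] using f.eq_sum G j
  have hα : ¬ P ∣ aeval G (linForm (f.c 0)) := fun h => by
    obtain ⟨j, hj⟩ := hPG
    rw [hsum] at hj
    exact hj (dvd_add (h.mul_right _)
      (Finset.dvd_sum fun l _ => (hdvd _ (f.dotProduct_succ l)).mul_right _))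
  obtain ⟨ν, b, hb, l₀, hl₀⟩ := exists_eq_pow_mul_and_exists_not_dvd
    (p := P) (a := fun l : Fin 2 => aeval G (linForm (f.c l.succ)))
    ⟨0, .of_prime_left hP.prime (hG _ (f.linForm_ne_zero _))⟩
  have hη : ∀ k : Fin 2, aeval (fun j => ∑ l : Fin 2, b l * C (f.w l.succ j))
      (linForm (f.c k.succ)) = b k := fun k => by
    simp only [aeval_linForm, algebraMap_eq, Finset.mul_sum]
    rw [Finset.sum_comm]
    have hdual : ∀ l : Fin 2, ∑ j, C (f.c k.succ j) * (b l * C (f.w l.succ j)) =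
        b l * C (if k = l then 1 else 0) := fun l => by
      have hkl := f.dotProduct_eq k.succ l.succ
      simp only [Fin.succ_inj] at hkl
      rw [← hkl, dotProduct, map_sum, Finset.mul_sum]
      exact Finset.sum_congr rfl fun j _ => by rw [map_mul, mul_left_comm]
    simp [hdual]
  refine ⟨_, fun j => ∑ l : Fin 2, b l * C (f.w l.succ j), ν, f.c l₀.succ, hα, ?_,
    f.dotProduct_succ l₀, (hη l₀).symm ▸ hl₀, fun j => ?_⟩
  · rw [Nat.pos_iff_ne_zero]
    rintro rfl
    have hbl : aeval G (linForm (f.c l₀.succ)) = P ^ 0 * b l₀ := hb l₀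
    rw [pow_zero, one_mul] at hbl
    exact hl₀ (hbl ▸ hdvd _ (f.dotProduct_succ l₀))
  · rw [hsum, Finset.mul_sum]
    simp only [hb, mul_assoc]

lemma IsReduction.exists_contractsTo (hF : IsReduction x d m F) {e : ℕ} {H H' : PolyRing}
    (hG : IsRationalInverse F G e H H') (hP : Irreducible P) (hPG : ∃ j, ¬ P ∣ G j)
    (hPH : P ∣ H') :
    ∃ i ν, ContractsTo G P (x i) ν ∧ emultiplicity P H' ≤ (ν * m i : ℕ) := by
  obtain ⟨i, hi⟩ := hF.exists_forall_dvd_aeval_linForm hP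
    (fun j => hG.aeval_right j ▸ hPH.mul_right _) hPG
  obtain ⟨α, η, ν, c, hα, hν, hc, hη, hGl⟩ := exists_eq_mul_add_pow_mul hP hPG
    (fun c hc => hG.aeval_ne_zero (linForm_isHomogeneous c) hc) hi
  refine ⟨i, ν, ⟨α, η, fun h0 => hα (h0 ▸ dvd_zero P), hGl⟩, ?_⟩
  obtain ⟨j, hj⟩ := hF.exists_not_pow_succ_dvd_aeval hP hα hc hη ν hν
  rw [← funext hGl, hG.aeval_right] at hj
  have hlt := emultiplicity_lt_iff_not_dvd.2 fun h => hj (h.mul_right _)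
  exact Order.le_of_lt_add_one (by exact_mod_cast hlt)

/-! ### Numerical classes of reductions -/

lemma pow_dvd_of_forall_irreducible {R : Type*} [CommRing R] [IsDomain R]
    [UniqueFactorizationMonoid R] {H A : R} {n : ℕ} (hH : H ≠ 0)
    (h : ∀ P, Irreducible P → P ∣ H → P ^ (n * multiplicity P H) ∣ A) : H ^ n ∣ A := by
  refine (UniqueFactorizationMonoid.dvd_iff_emultiplicity_le (pow_ne_zero n hH)).2 fun P hP => ?_
  have hfin := FiniteMultiplicity.of_prime_left hP hH
  rw [emultiplicity_pow hP, hfin.emultiplicity_eq_multiplicity]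
  by_cases hPH : P ∣ H
  · exact_mod_cast le_emultiplicity_of_pow_dvd (h P hP.irreducible hPH)
  · simp [multiplicity_eq_zero.2 hPH]

section Numerics

variable {e : ℕ} {H H' : PolyRing}

namespace IsReduction

lemma pow_dvd_of_forall_contractsTo (hF : IsReduction x d m F) (hG : IsRationalInverse F G e H H')
    (hprim : ∀ P, Irreducible P → ∃ j, ¬ P ∣ G j) {n : ℕ} {A : PolyRing}
    (h : ∀ P i ν, ContractsTo G P (x i) ν → P ^ (n * (ν * m i)) ∣ A) : H' ^ n ∣ A := by
  refine pow_dvd_of_forall_irreducible hG.right_ne_zero fun P hP hPH => ?_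
  obtain ⟨i, ν, hν, hle⟩ := hF.exists_contractsTo hG hP (hprim P hP) hPH
  refine (pow_dvd_pow P (Nat.mul_le_mul_left n ?_)).trans (h P i ν hν)
  rw [(FiniteMultiplicity.of_prime_left hP.prime hG.right_ne_zero).emultiplicity_eq_multiplicity]
    at hle
  exact_mod_cast hle

-- Dividing by `H' ^ n`, the pull-back by `G` identifies these forms with forms of degree `n`.
lemma finrank_formsVanishing_le (hF : IsReduction x d m F) (hG : IsRationalInverse F G e H H')
    (hprim : ∀ P, Irreducible P → ∃ j, ¬ P ∣ G j) (n : ℕ) :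
    Module.finrank ℂ (formsVanishing x (n * d) fun i => n * m i) ≤ (n + 2).choose 2 := by
  obtain ⟨k, hk, hHk⟩ := (hG.symm hF.homogeneous).exists_isHomogeneous_left hG.isHomogeneous
  have hinj : Function.Injective ((aeval G).toLinearMap.domRestrict
      (formsVanishing x (n * d) fun i => n * m i)) :=
    LinearMap.ker_eq_bot.1 (LinearMap.ker_eq_bot'.2 fun s hs => by
      by_contra hs₀
      exact hG.aeval_ne_zero (mem_formsVanishing.1 s.2).1 (fun h => hs₀ (Subtype.ext h)) hs)
  rw [← LinearMap.finrank_range_of_inj hinj, LinearMap.range_domRestrict,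
    ← finrank_homogeneousSubmodule_fin_three,
    ← finrank_map_mulLeft (pow_ne_zero n hG.right_ne_zero) (homogeneousSubmodule (Fin 3) ℂ n)]
  refine Submodule.finrank_mono ?_
  rintro _ ⟨s, hs, rfl⟩
  rw [SetLike.mem_coe, mem_formsVanishing] at hs
  obtain ⟨Z, hZ⟩ : H' ^ n ∣ aeval G s :=
    hF.pow_dvd_of_forall_contractsTo hG hprim fun P i ν hν => by
      rw [mul_left_comm]
      exact hν.pow_dvd_aeval hs.1 (hs.2 i)
  have hZ' : (H' ^ n * Z).IsHomogeneous (k * n + n) := by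
    rw [← hZ, show k * n + n = e * (n * d) by rw [mul_left_comm, hk]; ring]
    exact hs.1.aeval G hG.isHomogeneous
  exact ⟨Z, isHomogeneous_of_mul_right hZ' (hHk.pow n) (pow_ne_zero n hG.right_ne_zero), hZ.symm⟩

lemma sq_mul_sq_add_le (hF : IsReduction x d m F) (hG : IsRationalInverse F G e H H')
    (hprim : ∀ P, Irreducible P → ∃ j, ¬ P ∣ G j) (n : ℕ) :
    (n : ℚ) ^ 2 * d ^ 2 + 3 * n * d ≤
      n ^ 2 + 3 * n + n ^ 2 * ∑ i, (m i : ℚ) ^ 2 + n * ∑ i, (m i : ℚ) := by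
  have h := (le_finrank_formsVanishing x (n * d) fun i => n * m i).trans
    (Nat.add_le_add_right (hF.finrank_formsVanishing_le hG hprim n) _)
  have hsum : ((∑ i, (n * m i + 1).choose 2 : ℕ) : ℚ) =
      (n ^ 2 * ∑ i, (m i : ℚ) ^ 2 + n * ∑ i, (m i : ℚ)) / 2 := by
    push_cast [Nat.cast_choose_two, Finset.mul_sum]
    rw [← Finset.sum_add_distrib, Finset.sum_div]
    exact Finset.sum_congr rfl fun i _ => by ring
  rw [← Nat.cast_le (α := ℚ), Nat.cast_add, hsum] at h
  push_cast [Nat.cast_choose_two] at h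
  linarith

lemma sq_le_sum_sq_add_one (hF : IsReduction x d m F) (hG : IsRationalInverse F G e H H')
    (hprim : ∀ P, Irreducible P → ∃ j, ¬ P ∣ G j) : d ^ 2 ≤ ∑ i, m i ^ 2 + 1 := by
  by_contra! hlt
  have h := hF.sq_mul_sq_add_le hG hprim (∑ i, m i + 4)
  have hd : ∑ i, (m i : ℚ) ^ 2 + 2 ≤ d ^ 2 := by exact_mod_cast hlt
  have := mul_le_mul_of_nonneg_left hd (sq_nonneg ((∑ i, m i + 4 : ℕ) : ℚ))
  push_cast at *
  have : (0 : ℚ) ≤ d := Nat.cast_nonneg d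
  have : (0 : ℚ) ≤ ∑ i, (m i : ℚ) := Finset.sum_nonneg fun i _ => Nat.cast_nonneg _
  nlinarith

lemma three_mul_le (hF : IsReduction x d m F) (hG : IsRationalInverse F G e H H')
    (hprim : ∀ P, Irreducible P → ∃ j, ¬ P ∣ G j) (hd : d ^ 2 = ∑ i, m i ^ 2 + 1) :
    3 * d ≤ ∑ i, m i + 3 := by
  have h := hF.sq_mul_sq_add_le hG hprim 1
  rw [← Nat.cast_inj (R := ℚ)] at hd
  rw [← Nat.cast_le (α := ℚ)]
  push_cast at *
  linarith

end IsReduction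

end Numerics

end Reductions

lemma dvd_aeval_sub_aeval {σ R A : Type*} [CommRing R] [CommRing A] [Algebra R A] {P : A}
    {f g : σ → A} (h : ∀ j, P ∣ f j - g j) (s : MvPolynomial σ R) :
    P ∣ aeval f s - aeval g s := by
  simp only [← Ideal.mem_span_singleton, ← Ideal.Quotient.mk_eq_mk_iff_sub_mem] at h ⊢
  have hcomp := fun G : σ → A => comp_aeval_apply G (Ideal.Quotient.mkₐ R (Ideal.span {P})) s
  simp only [Ideal.Quotient.mkₐ_eq_mk] at hcomp
  rw [hcomp, hcomp, funext h]

section SelfIntersection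

variable {r d e : ℕ} {x : Fin r → Plane} {m : Fin r → ℕ} {F G : Fin 3 → PolyRing}
  {H H' P : PolyRing}

lemma IsRationalInverse.dvd_mul_linForm_sub (hG : IsRationalInverse F G e H H') {p : Plane}
    {α : PolyRing} (hF : ∀ j, P ∣ F j - α * C (eval p.rep (F j))) (c : Fin 3 → ℂ) :
    P ∣ H * linForm c - α ^ e * C (eval p.rep H * (c ⬝ᵥ p.rep)) := by
  have hs := (linForm_isHomogeneous c).aeval G hG.isHomogeneous
  have h := dvd_aeval_sub_aeval hF (aeval G (linForm c))
  rw [mul_one] at hs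
  rw [aeval_mul_of_isHomogeneous hs, hG.aeval_aeval (linForm_isHomogeneous c), pow_one] at h
  have hC : aeval (fun j => (C (eval p.rep (F j)) : PolyRing)) (aeval G (linForm c)) =
      C (eval p.rep H * (c ⬝ᵥ p.rep)) := by
    rw [← eval_linForm, ← map_mul, ← pow_one H, ← hG.aeval_aeval (linForm_isHomogeneous c),
      eval_aeval]
    exact aeval_algebraMap_apply (B := PolyRing) _ _
  rwa [hC] at h

namespace IsReduction

lemma form_mem_formsVanishing (hF : IsReduction x d m F) (j : Fin 3) : F j ∈ formsVanishing x d m :=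
  mem_formsVanishing.2 ⟨hF.homogeneous j, fun i => hF.vanishing i j⟩

lemma aeval_linForm_mem_formsVanishing (hF : IsReduction x d m F) (c : Fin 3 → ℂ) :
    aeval F (linForm c) ∈ formsVanishing x d m := by
  rw [aeval_linForm]
  exact Submodule.sum_mem _ fun j _ => by
    simpa only [Algebra.smul_def] using Submodule.smul_mem _ (c j) (hF.form_mem_formsVanishing j)

lemma exists_not_dvd (hF : IsReduction x d m F) (hP : Irreducible P) : ∃ j, ¬ P ∣ F j := by
  classical
  by_contra! h
  have : (Ideal.span {P}).IsPrime := (Ideal.span_singleton_prime hP.ne_zero).2 hP.prime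
  obtain ⟨p, hp, -, hpP⟩ := exists_point_of_isPrime (I := Ideal.span {P})
    (isHomogeneous_one (Fin 3) ℂ) (Ideal.one_notMem _) (fun p => by
      simpa only [Ideal.mem_span_singleton] using exists_linForm_not_dvd hP.not_isUnit p)
    (Finset.univ.image x)
  obtain ⟨j, hj⟩ := hF.noBasePoint p fun i hi =>
    hp (hi ▸ Finset.mem_image_of_mem x (Finset.mem_univ i))
  exact hj (hpP _ (Ideal.mem_span_singleton.2 (h j)) d (hF.homogeneous j))

-- A common component would be contracted to `p`, and so `H` would vanish on it as well.
lemma isRelPrime_aeval_linForm (hF : IsReduction x d m F) (hG : IsRationalInverse F G e H H')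
    {p : Plane} (hp : eval p.rep H ≠ 0) (f : AdaptedFrame fun j => eval p.rep (F j)) :
    IsRelPrime (aeval F (linForm (f.c 1))) (aeval F (linForm (f.c 2))) := by
  refine WfDvdMonoid.isRelPrime_of_no_irreducible_factors (fun h =>
    (hG.symm hF.homogeneous).aeval_ne_zero (linForm_isHomogeneous _) (f.linForm_ne_zero 1) h.1)
    fun P hP h₁ h₂ => ?_
  have hFj : ∀ j, P ∣ F j - aeval F (linForm (f.c 0)) * C (eval p.rep (F j)) := fun j => by
    have hsum := f.eq_sum F j
    rw [Fin.sum_univ_three, f.w_zero, algebraMap_eq] at hsum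
    rw [sub_eq_of_eq_add' (hsum.trans (add_assoc _ _ _))]
    exact dvd_add (h₁.mul_right _) (h₂.mul_right _)
  have hα : ¬ P ∣ aeval F (linForm (f.c 0)) := fun h => by
    obtain ⟨j, hj⟩ := hF.exists_not_dvd hP
    exact hj ((dvd_sub_left (h.mul_right _)).1 (hFj j))
  obtain ⟨c, hc, hPc⟩ := exists_linForm_not_dvd hP.not_isUnit p
  have hPH : P ∣ H := by
    have h := hG.dvd_mul_linForm_sub hFj c
    rw [hc, mul_zero, C_0, mul_zero, sub_zero] at h
    exact (hP.prime.dvd_or_dvd h).resolve_right hPc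
  obtain ⟨c₀, hc₀⟩ : ∃ c₀ : Fin 3 → ℂ, c₀ ⬝ᵥ p.rep ≠ 0 := by
    by_contra! h
    exact p.rep_nonzero (dotProduct_eq_zero _ fun w => (dotProduct_comm _ w).trans (h w))
  have h := (dvd_sub_right (hPH.mul_right _)).1 (hG.dvd_mul_linForm_sub hFj c₀)
  refine hα (hP.prime.dvd_of_dvd_pow ((IsUnit.dvd_mul_right ?_).1 h))
  exact (isUnit_iff_ne_zero.2 (mul_ne_zero hp hc₀)).map C

lemma sum_sq_add_one_le (hF : IsReduction x d m F) (hG : IsRationalInverse F G e H H')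
    (hx : Function.Injective x) : ∑ i, m i ^ 2 + 1 ≤ d ^ 2 := by
  classical
  obtain ⟨k, -, hHk⟩ := hG.exists_isHomogeneous_left hF.homogeneous
  obtain ⟨p, hpx, hpH⟩ := exists_point_eval_ne_zero hHk hG.left_ne_zero (Finset.univ.image x)
  have hp : ∀ i, p ≠ x i := fun i hi =>
    hpx (hi ▸ Finset.mem_image_of_mem x (Finset.mem_univ i))
  obtain ⟨j, hj⟩ := hF.noBasePoint p hp
  obtain ⟨f⟩ := AdaptedFrame.exists_of_ne_zero (v := fun j => eval p.rep (F j))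
    fun h => hj (congrFun h j)
  have hmem : ∀ l : Fin 2, aeval F (linForm (f.c l.succ)) ∈
      formsVanishing (fun i : Option (Fin r) => i.elim p x) d fun i => i.elim 1 m := fun l => by
    have h := mem_formsVanishing.1 (hF.aeval_linForm_mem_formsVanishing (f.c l.succ))
    refine mem_formsVanishing.2 ⟨h.1, Option.forall.2 ⟨?_, h.2⟩⟩
    rw [Option.elim_none, Option.elim_none, vanishesToOrder_one_iff, eval_aeval, eval_linForm]
    exact f.dotProduct_succ l
  have hne : ∀ k, aeval F (linForm (f.c k)) ≠ 0 := fun k =>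
    (hG.symm hF.homogeneous).aeval_ne_zero (linForm_isHomogeneous _) (f.linForm_ne_zero k)
  have hle := sum_mul_le_mul_of_isRelPrime
    (x := fun i : Option (Fin r) => i.elim p x)
    (Option.injective_iff.2 ⟨hx, fun ⟨i, hi⟩ => hp i hi.symm⟩) (hmem 0) (hmem 1) (hne 1) (hne 2)
    (hF.isRelPrime_aeval_linForm hG hpH f)
  rw [Fintype.sum_option] at hle
  simpa only [Option.elim_none, Option.elim_some, ← sq, one_pow, add_comm] using hle

end IsReduction

end SelfIntersection

/-! ### The Jacobian determinant -/

lemma pderiv_aeval {σ τ R : Type*} [CommSemiring R] [Fintype σ] (f : σ → MvPolynomial τ R)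
    (j : τ) (p : MvPolynomial σ R) :
    pderiv j (aeval f p) = ∑ i, aeval f (pderiv i p) * pderiv j (f i) := by
  classical
  induction p using MvPolynomial.induction_on with
  | C a => simp
  | add p q hp hq => simp only [map_add, add_mul, Finset.sum_add_distrib, hp, hq]
  | mul_X p i hp =>
    simp only [map_mul, aeval_X, pderiv_mul, map_add, add_mul, Finset.sum_add_distrib, hp,
      Finset.sum_mul, pderiv_X, Pi.single_apply, apply_ite (aeval f), map_zero, mul_ite,
      mul_one, mul_zero, ite_mul, zero_mul, Finset.sum_ite_eq, Finset.mem_univ, if_true]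
    congr 1
    exact Finset.sum_congr rfl fun l _ => mul_right_comm _ _ _

/-- The Jacobian matrix of the polynomial map with components `f`. -/
def jacobian {σ τ R : Type*} [CommSemiring R] (f : σ → MvPolynomial τ R) :
    Matrix σ τ (MvPolynomial τ R) :=
  Matrix.of fun i j => pderiv j (f i)

lemma jacobian_aeval {σ τ υ R : Type*} [CommSemiring R] [Fintype τ]
    (g : σ → MvPolynomial τ R) (f : τ → MvPolynomial υ R) :
    jacobian (fun i => aeval f (g i)) = (jacobian g).map (aeval f) * jacobian f := by
  ext1 i j
  exact pderiv_aeval f j (g i)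

lemma isHomogeneous_det {n σ R : Type*} [Fintype n] [DecidableEq n] [CommRing R]
    {M : Matrix n n (MvPolynomial σ R)} {d : ℕ} (hM : ∀ i j, (M i j).IsHomogeneous d) :
    M.det.IsHomogeneous (Fintype.card n * d) := by
  rw [Matrix.det_apply]
  refine IsHomogeneous.sum _ _ _ fun τ _ => ?_
  have h := IsHomogeneous.prod Finset.univ _ _ fun i _ => hM (τ i) i
  rw [Finset.sum_const, smul_eq_mul, Finset.card_univ] at h
  rw [Units.smul_def]
  exact (homogeneousSubmodule σ R _).toAddSubgroup.zsmul_mem h _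

lemma det_jacobian_mul_X {H : PolyRing} {k : ℕ} (hH : H.IsHomogeneous k) :
    (jacobian fun i => H * X i).det = ((k + 1 : ℕ) : PolyRing) * H ^ 3 := by
  have heuler := hH.sum_X_mul_pderiv
  rw [Fin.sum_univ_three] at heuler
  rw [Matrix.det_fin_three]
  simp only [jacobian, Matrix.of_apply, pderiv_mul, pderiv_X, Pi.single_apply]
  simp only [↓reduceIte, mul_one, Fin.reduceEq, mul_zero, add_zero, zero_ne_one, one_ne_zero,
    Nat.cast_add, Nat.cast_one]
  linear_combination H ^ 2 * heuler

lemma dvd_det_of_forall_apply {R : Type*} [CommRing R] {q : R} {v η a b : Fin 3 → R}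
    {M : Matrix (Fin 3) (Fin 3) R} (hM : ∀ i j, q ∣ M i j - (v i * a j + η i * b j)) :
    q ∣ M.det := by
  simp only [← Ideal.mem_span_singleton, ← Ideal.Quotient.mk_eq_mk_iff_sub_mem] at hM
  rw [← Ideal.mem_span_singleton, ← Ideal.Quotient.eq_zero_iff_mem, RingHom.map_det,
    Matrix.det_fin_three]
  simp only [RingHom.mapMatrix_apply, Matrix.map_apply, hM, map_add, map_mul]
  ring

section CanonicalDegree

variable {r d e : ℕ} {x : Fin r → Plane} {m : Fin r → ℕ} {F G : Fin 3 → PolyRing}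
  {H H' P : PolyRing}

lemma ContractsTo.pow_dvd_det_jacobian {p : Plane} {ν : ℕ} (h : ContractsTo G P p ν) :
    P ^ ν ∣ (jacobian G).det := by
  obtain ⟨α, η, -, hG⟩ := h
  refine dvd_det_of_forall_apply (v := fun i => C (p.rep i)) (a := fun j => pderiv j α) (η := η)
    (b := fun j => pderiv j (P ^ ν)) fun i j => ⟨pderiv j (η i), ?_⟩
  simp only [jacobian, Matrix.of_apply, hG, map_add, pderiv_mul, pderiv_C]
  ring

lemma IsRationalInverse.det_jacobian_ne_zero (hG : IsRationalInverse F G e H H')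
    (hF : ∀ j, (F j).IsHomogeneous d) : (jacobian G).det ≠ 0 := fun h => by
  obtain ⟨k, -, hHk⟩ := hG.exists_isHomogeneous_left hF
  have hdet := det_jacobian_mul_X hHk
  rw [← funext hG.aeval_left, jacobian_aeval, Matrix.det_mul, ← AlgHom.mapMatrix_apply,
    ← AlgHom.map_det, h, map_zero, zero_mul] at hdet
  exact mul_ne_zero (Nat.cast_ne_zero.2 k.succ_ne_zero) (pow_ne_zero 3 hG.left_ne_zero) hdet.symm

namespace IsReduction

lemma dvd_aeval_mul_det_jacobian (hF : IsReduction x d m F) (hG : IsRationalInverse F G e H H')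
    (hprim : ∀ P, Irreducible P → ∃ j, ¬ P ∣ G j) {D : ℕ} {Q : PolyRing}
    (hQ : Q ∈ formsVanishing x D fun i => m i - 1) : H' ∣ aeval G Q * (jacobian G).det := by
  rw [mem_formsVanishing] at hQ
  have hpow : ∀ P i ν, ContractsTo G P (x i) ν →
      P ^ (1 * (ν * m i)) ∣ aeval G Q * (jacobian G).det := fun P i ν hν => by
    have hle : 1 * (ν * m i) ≤ ν * (m i - 1) + ν := by
      rw [one_mul, ← Nat.mul_succ]
      exact Nat.mul_le_mul_left ν (by lia)
    refine (pow_dvd_pow P hle).trans ?_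
    rw [pow_add]
    exact mul_dvd_mul (hν.pow_dvd_aeval hQ.1 (hQ.2 i)) hν.pow_dvd_det_jacobian
  have hdvd := hF.pow_dvd_of_forall_contractsTo hG hprim hpow
  rwa [pow_one] at hdvd

-- The canonical class of `X` has no sections, as the pull-back by `G` would show on the plane.
lemma eq_zero_of_mem_formsVanishing_sub_one (hF : IsReduction x (d + 3) m F)
    (hG : IsRationalInverse F G e H H') (hprim : ∀ P, Irreducible P → ∃ j, ¬ P ∣ G j) {Q : PolyRing}
    (hQ : Q ∈ formsVanishing x d fun i => m i - 1) : Q = 0 := by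
  by_contra hQ₀
  obtain ⟨Z, hZ⟩ := hF.dvd_aeval_mul_det_jacobian hG hprim hQ
  rw [mem_formsVanishing] at hQ
  obtain ⟨k, hk, hHk⟩ := (hG.symm hF.homogeneous).exists_isHomogeneous_left hG.isHomogeneous
  have hjac : (jacobian G).det.IsHomogeneous (Fintype.card (Fin 3) * (e - 1)) :=
    isHomogeneous_det fun i j => (hG.isHomogeneous i).pderiv
  have hdeg := (hQ.1.aeval G hG.isHomogeneous).mul hjac
  have hne := mul_ne_zero (hG.aeval_ne_zero hQ.1 hQ₀) (hG.det_jacobian_ne_zero hF.homogeneous)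
  rw [hZ] at hdeg hne
  obtain ⟨k', l, hkl, hk', -⟩ := isHomogeneous_of_mul hdeg hne
  obtain rfl := hk'.inj_right hHk hG.right_ne_zero
  rw [Fintype.card_fin] at hkl
  lia

lemma sum_add_three_le (hF : IsReduction x d m F) (hG : IsRationalInverse F G e H H')
    (hprim : ∀ P, Irreducible P → ∃ j, ¬ P ∣ G j) (hd : d ^ 2 = ∑ i, m i ^ 2 + 1) :
    ∑ i, m i + 3 ≤ 3 * d := by
  have hsq : ∑ i, m i ≤ ∑ i, m i ^ 2 := Finset.sum_le_sum fun i _ => Nat.le_self_pow two_ne_zero _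
  rcases lt_or_ge d 3 with hd3 | hd3
  · interval_cases d <;> lia
  obtain ⟨c, rfl⟩ := Nat.exists_eq_add_of_le' hd3
  have hbot : formsVanishing x c (fun i => m i - 1) = ⊥ :=
    (Submodule.eq_bot_iff _).2 fun Q hQ => hF.eq_zero_of_mem_formsVanishing_sub_one hG hprim hQ
  have h := le_finrank_formsVanishing x c fun i => m i - 1
  rw [hbot, finrank_bot, zero_add] at h
  simp only [sub_one_add_one_choose_two] at h
  rw [← Nat.cast_le (α := ℚ)] at h ⊢
  rw [← Nat.cast_inj (R := ℚ)] at hd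
  push_cast [Nat.cast_choose_two, ← Finset.sum_div, mul_sub, Finset.sum_sub_distrib] at h hd ⊢
  simp only [mul_one, ← sq] at h
  linarith

lemma numerics (hF : IsReduction x d m F) (hx : Function.Injective x) :
    d ^ 2 = ∑ i, m i ^ 2 + 1 ∧ 3 * d = ∑ i, m i + 3 := by
  obtain ⟨e, G, H, H', hG, hH, hH', hFG, hGF⟩ := hF.birational
  obtain ⟨e, G, H, H', hG, hprim⟩ :=
    exists_primitive_isRationalInverse hF.homogeneous ⟨hG, hH, hH', hFG, hGF⟩
  have hd := (hF.sq_le_sum_sq_add_one hG hprim).antisymm (hF.sum_sq_add_one_le hG hx)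
  exact ⟨hd, (hF.three_mul_le hG hprim hd).antisymm (hF.sum_add_three_le hG hprim hd)⟩

end IsReduction

end CanonicalDegree

/-! ### The intersection form and the light cone -/

section Inter

variable {r : ℕ}

lemma inter_comm (α β : NS r) : inter α β = inter β α := by
  simp only [inter, mul_comm]

lemma inter_add_right (α β γ : NS r) : inter α (β + γ) = inter α β + inter α γ := by
  simp only [inter, Prod.fst_add, Prod.snd_add, Pi.add_apply, mul_add, Finset.sum_add_distrib]
  ring

lemma inter_smul_right (t : ℝ) (α β : NS r) : inter α (t • β) = t * inter α β := by
  simp only [inter, Prod.smul_fst, Prod.smul_snd, Pi.smul_apply, smul_eq_mul, mul_sub,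
    Finset.mul_sum, mul_left_comm]

/-- The intersection product, as a bilinear form. -/
def interForm (r : ℕ) : LinearMap.BilinForm ℝ (NS r) :=
  LinearMap.mk₂ ℝ inter (fun α β γ => by simp only [inter_comm _ γ, inter_add_right])
    (fun t α β => by simp only [inter_comm _ β, inter_smul_right, smul_eq_mul])
    inter_add_right fun t α β => inter_smul_right t α β

lemma interForm_apply (α β : NS r) : interForm r α β = inter α β := rfl

lemma inter_zero_right (α : NS r) : inter α 0 = 0 := map_zero (interForm r α)

lemma inter_neg_right (α β : NS r) : inter α (-β) = -inter α β := map_neg (interForm r α) β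

lemma inter_sub_right (α β γ : NS r) : inter α (β - γ) = inter α β - inter α γ :=
  map_sub (interForm r α) β γ

lemma inter_add_left (α β γ : NS r) : inter (α + β) γ = inter α γ + inter β γ :=
  (interForm r).map_add₂ α β γ

lemma inter_smul_left (t : ℝ) (α β : NS r) : inter (t • α) β = t * inter α β :=
  (interForm r).map_smul₂ t α β

lemma inter_neg_left (α β : NS r) : inter (-α) β = -inter α β := (interForm r).map_neg₂ α β

lemma inter_sub_left (α β γ : NS r) : inter (α - β) γ = inter α γ - inter β γ :=
  (interForm r).map_sub₂ α β γ

lemma continuous_inter (α : NS r) : Continuous (inter α) := by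
  unfold inter
  fun_prop

lemma ray_eq_span (α : NS r) : ray α = Submodule.span ℝ≥0 {α} := by
  ext β
  simp only [ray, SetLike.mem_coe, Submodule.mem_span_singleton]
  exact ⟨fun ⟨t, ht, h⟩ => ⟨⟨t, ht⟩, h.symm⟩, fun ⟨t, h⟩ => ⟨t, t.2, h.symm⟩⟩

lemma mem_ray_self (α : NS r) : α ∈ ray α := ⟨1, zero_le_one, (one_smul ℝ α).symm⟩

lemma ray_smul {t : ℝ} (ht : 0 < t) (α : NS r) : ray (t • α) = ray α := by
  ext β
  constructor
  · rintro ⟨u, hu, rfl⟩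
    exact ⟨u * t, mul_nonneg hu ht.le, smul_smul u t α⟩
  · rintro ⟨u, hu, rfl⟩
    exact ⟨u * t⁻¹, mul_nonneg hu (inv_nonneg.2 ht.le), by
      rw [smul_smul, inv_mul_cancel_right₀ ht.ne']⟩

lemma ray_eq_of_mem {α β : NS r} (hβ : β ∈ ray α) (hβ₀ : β ≠ 0) : ray β = ray α := by
  obtain ⟨t, ht, rfl⟩ := hβ
  exact ray_smul (ht.lt_of_ne' fun h => hβ₀ (by rw [h, zero_smul])) α

lemma sum_sq_le_sq_of_inter_self_nonneg {α : NS r} (hα : 0 ≤ inter α α) :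
    ∑ i, α.2 i ^ 2 ≤ α.1 ^ 2 := by
  simpa only [inter, sub_nonneg, ← sq] using hα

lemma inter_nonneg_of_inter_self_nonneg {α β : NS r} (hα : 0 ≤ inter α α) (hβ : 0 ≤ inter β β)
    (hα₁ : 0 ≤ α.1) (hβ₁ : 0 ≤ β.1) : 0 ≤ inter α β := by
  refine sub_nonneg.2 (le_of_abs_le (abs_le_of_sq_le_sq ?_ (mul_nonneg hα₁ hβ₁)))
  calc (∑ i, α.2 i * β.2 i) ^ 2 ≤ (∑ i, α.2 i ^ 2) * ∑ i, β.2 i ^ 2 :=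
        Finset.sum_mul_sq_le_sq_mul_sq _ _ _
    _ ≤ α.1 ^ 2 * β.1 ^ 2 := by
        gcongr
        exacts [sum_sq_le_sq_of_inter_self_nonneg hα, sum_sq_le_sq_of_inter_self_nonneg hβ]
    _ = (α.1 * β.1) ^ 2 := (mul_pow _ _ _).symm

variable (r) in
/-- The classes of nonnegative square and nonnegative degree. This cone turns out to be `Q`, but
its definition does not refer to the points of the plane. -/
def lightCone : Submodule ℝ≥0 (NS r) where
  carrier := {α | 0 ≤ inter α α ∧ 0 ≤ α.1}
  zero_mem' := ⟨(inter_zero_right 0).ge, le_rfl⟩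
  add_mem' {α β} hα hβ := by
    refine ⟨?_, add_nonneg hα.2 hβ.2⟩
    have h := inter_nonneg_of_inter_self_nonneg hα.1 hβ.1 hα.2 hβ.2
    rw [inter_add_left, inter_add_right, inter_add_right, inter_comm β α]
    linarith [hα.1, hβ.1]
  smul_mem' t α hα := by
    refine ⟨?_, mul_nonneg t.2 hα.2⟩
    rw [NNReal.smul_def, inter_smul_left, inter_smul_right]
    exact mul_nonneg t.2 (mul_nonneg t.2 hα.1)

lemma mem_lightCone {α : NS r} : α ∈ lightCone r ↔ 0 ≤ inter α α ∧ 0 ≤ α.1 := Iff.rfl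

lemma inter_nonneg_of_mem_lightCone {α β : NS r} (hα : α ∈ lightCone r) (hβ : β ∈ lightCone r) :
    0 ≤ inter α β :=
  inter_nonneg_of_inter_self_nonneg hα.1 hβ.1 hα.2 hβ.2

lemma fst_pos_of_mem_lightCone {α : NS r} (hα : α ∈ lightCone r) (hα₀ : α ≠ 0) : 0 < α.1 := by
  refine hα.2.lt_of_ne' fun h => hα₀ ?_
  have hsum := sum_sq_le_sq_of_inter_self_nonneg hα.1
  rw [h, sq (0 : ℝ), zero_mul] at hsum
  have hzero := (Finset.sum_eq_zero_iff_of_nonneg fun i _ => sq_nonneg (α.2 i)).1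
    (hsum.antisymm (Finset.sum_nonneg fun i _ => sq_nonneg _))
  exact Prod.ext h (funext fun i => pow_eq_zero_iff two_ne_zero |>.1 (hzero i (Finset.mem_univ i)))

end Inter

open Filter Topology

/-! ### Intersections of integral curves -/

section Curves

variable {r : ℕ} {x : Fin r → Plane}

lemma isHomogeneous_of_isUnit {σ R : Type*} [CommRing R] [IsReduced R] {u : MvPolynomial σ R}
    (hu : IsUnit u) : u.IsHomogeneous 0 :=
  (totalDegree_zero_iff_isHomogeneous _).1 (isUnit_iff_totalDegree_of_isReduced.1 hu).2

lemma multAt_of_isUnit (p : Plane) {F : PolyRing} (hF : IsUnit F) : multAt p F = 0 :=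
  Nat.le_zero.1 (multAt_le_of_isHomogeneous p hF.ne_zero (isHomogeneous_of_isUnit hF))

lemma multAt_eq_of_associated {F G : PolyRing} (h : Associated F G) (hF : F ≠ 0) (p : Plane) :
    multAt p F = multAt p G := by
  obtain ⟨u, rfl⟩ := h
  rw [multAt_mul p hF u.ne_zero, multAt_of_isUnit p u.isUnit, add_zero]

/-- The class `d L - ∑ i, m i E i`. -/
def planeClass (d : ℕ) (m : Fin r → ℕ) : NS r := (d, fun i => -(m i : ℝ))

lemma inter_planeClass (d e : ℕ) (m k : Fin r → ℕ) :
    inter (planeClass d m) (planeClass e k) = (d * e : ℕ) - (∑ i, m i * k i : ℕ) := by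
  simp only [inter, planeClass, neg_mul_neg]
  push_cast
  rfl

lemma inter_canonicalClass (α : NS r) : inter (canonicalClass r) α = -3 * α.1 - ∑ i, α.2 i := by
  simp only [inter, canonicalClass, one_mul]

lemma inter_canonicalClass_planeClass (d : ℕ) (m : Fin r → ℕ) :
    inter (canonicalClass r) (planeClass d m) = (∑ i, m i : ℕ) - (3 * d : ℕ) := by
  rw [inter_canonicalClass]
  push_cast [planeClass, Finset.sum_neg_distrib]
  ring

lemma cls_properTransform (D : PlaneCurve) :
    (IntegralCurve.properTransform D).cls x =
      planeClass D.degree fun i => multAt (x i) D.form := rfl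

lemma inter_cls_exceptional (α : NS r) (i : Fin r) :
    inter α ((IntegralCurve.exceptional i).cls x) = -α.2 i := by
  simp [inter, IntegralCurve.cls, Pi.single_apply]

namespace PlaneCurve

variable (D D' : PlaneCurve)

lemma form_mem_formsVanishing (x : Fin r → Plane) :
    D.form ∈ formsVanishing x D.degree fun i => multAt (x i) D.form :=
  mem_formsVanishing.2 ⟨D.isHomogeneous, fun _ => vanishesToOrder_multAt _ D.irreducible.ne_zero⟩

lemma sum_multAt_mul_le (hx : Function.Injective x) {e : ℕ} {k : Fin r → ℕ} {F : PolyRing}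
    (hF : F ∈ formsVanishing x e k) (hDF : ¬ D.form ∣ F) :
    ∑ i, multAt (x i) D.form * k i ≤ D.degree * e :=
  sum_mul_le_mul_of_isRelPrime hx (D.form_mem_formsVanishing x) hF D.irreducible.ne_zero
    (fun h => hDF (h ▸ dvd_zero _)) (D.irreducible.isRelPrime_iff_not_dvd.2 hDF)

variable {D D'} in
lemma cls_eq_of_associated (h : Associated D.form D'.form) :
    (IntegralCurve.properTransform D).cls x = (IntegralCurve.properTransform D').cls x := by
  have hdeg : D.degree = D'.degree := by
    obtain ⟨u, hu⟩ := h
    have hDu := D.isHomogeneous.mul (isHomogeneous_of_isUnit u.isUnit)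
    rw [hu, add_zero] at hDu
    exact hDu.inj_right D'.isHomogeneous D'.irreducible.ne_zero
  simp only [IntegralCurve.cls, hdeg, multAt_eq_of_associated h D.irreducible.ne_zero]

end PlaneCurve

lemma cls_eq_or_inter_cls_nonneg (hx : Function.Injective x) (C C' : IntegralCurve r) :
    C.cls x = C'.cls x ∨ 0 ≤ inter (C.cls x) (C'.cls x) := by
  rcases C with i | D <;> rcases C' with j | D'
  · rcases eq_or_ne i j with rfl | hij
    · exact .inl rfl
    · right
      rw [inter_cls_exceptional]
      simp [IntegralCurve.cls, hij.symm]
  · right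
    rw [inter_comm, inter_cls_exceptional]
    simp [IntegralCurve.cls]
  · right
    rw [inter_cls_exceptional]
    simp [IntegralCurve.cls]
  · by_cases h : D.form ∣ D'.form
    · exact .inl (PlaneCurve.cls_eq_of_associated
        ((D.irreducible.dvd_irreducible_iff_associated D'.irreducible).1 h))
    · right
      refine (inter_planeClass _ _ _ _).ge.trans' (sub_nonneg.2 (Nat.cast_le.2 ?_))
      exact D.sum_multAt_mul_le hx (D'.form_mem_formsVanishing x) h

lemma exists_int_inter_cls_self (C : IntegralCurve r) :
    ∃ n : ℤ, inter (C.cls x) (C.cls x) = n := by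
  rcases C with i | D
  · exact ⟨-1, by rw [inter_cls_exceptional]; simp [IntegralCurve.cls]⟩
  · refine ⟨D.degree * D.degree - ∑ i, multAt (x i) D.form * multAt (x i) D.form, ?_⟩
    rw [cls_properTransform, inter_planeClass]
    push_cast
    rfl

lemma exists_int_inter_canonicalClass_cls (C : IntegralCurve r) :
    ∃ k : ℤ, inter (canonicalClass r) (C.cls x) = k := by
  rcases C with i | D
  · exact ⟨-1, by simp [inter_cls_exceptional, canonicalClass]⟩
  · refine ⟨∑ i, multAt (x i) D.form - 3 * D.degree, ?_⟩
    rw [cls_properTransform, inter_canonicalClass_planeClass]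
    push_cast
    rfl

/-- The adjunction inequality `C² + K · C = 2 pₐ(C) - 2 ≥ -2`. -/
lemma neg_two_le_inter_self_add (hx : Function.Injective x) (C : IntegralCurve r) :
    -2 ≤ inter (C.cls x) (C.cls x) + inter (canonicalClass r) (C.cls x) := by
  rcases C with i | D
  · simp only [inter_cls_exceptional]
    norm_num [canonicalClass, IntegralCurve.cls]
  have hdeg := pos_of_irreducible_of_isHomogeneous D.irreducible D.isHomogeneous
  have hgenus : ((∑ i, (multAt (x i) D.form).choose 2 : ℕ) : ℝ) ≤ ((D.degree - 1).choose 2 : ℕ) :=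
    Nat.cast_le.2 (sum_choose_two_multAt_le hx D.irreducible D.isHomogeneous)
  rw [Nat.cast_sum, Nat.cast_choose_two, Nat.cast_pred hdeg] at hgenus
  simp only [Nat.cast_choose_two, mul_sub_one, ← sq, ← Finset.sum_div,
    Finset.sum_sub_distrib] at hgenus
  rw [cls_properTransform, inter_planeClass, inter_canonicalClass_planeClass]
  push_cast
  simp only [← sq]
  linarith

lemma inter_self_and_inter_canonicalClass_of_neg (hx : Function.Injective x) (C : IntegralCurve r)
    (hCC : inter (C.cls x) (C.cls x) < 0) (hKC : inter (canonicalClass r) (C.cls x) < 0) :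
    inter (C.cls x) (C.cls x) = -1 ∧ inter (canonicalClass r) (C.cls x) = -1 := by
  have hadj := neg_two_le_inter_self_add hx C
  obtain ⟨n, hn⟩ := exists_int_inter_cls_self (x := x) C
  obtain ⟨k, hk⟩ := exists_int_inter_canonicalClass_cls (x := x) C
  rw [hn, hk] at hadj ⊢
  rw [hn] at hCC
  rw [hk] at hKC
  norm_cast at *
  lia

end Curves

/-! ### The Mori cone and the light cone -/

section MoriCone

variable {r : ℕ} {x : Fin r → Plane}

/-- The cone of effective classes, whose closure is the Mori cone. -/
def effCone (x : Fin r → Plane) : Submodule ℝ≥0 (NS r) :=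
  Submodule.span ℝ≥0 (Set.range (IntegralCurve.cls x))

lemma isClosed_moriCone : IsClosed (moriCone x) := isClosed_closure

lemma effCone_subset_moriCone : (effCone x : Set (NS r)) ⊆ moriCone x := subset_closure

lemma add_mem_moriCone {α β : NS r} (hα : α ∈ moriCone x) (hβ : β ∈ moriCone x) :
    α + β ∈ moriCone x :=
  (effCone x).topologicalClosure.add_mem hα hβ

lemma smul_mem_moriCone {α : NS r} (hα : α ∈ moriCone x) {t : ℝ} (ht : 0 ≤ t) :
    t • α ∈ moriCone x :=
  (effCone x).topologicalClosure.smul_mem ⟨t, ht⟩ hα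

lemma cls_mem_effCone (C : IntegralCurve r) : C.cls x ∈ effCone x :=
  Submodule.subset_span ⟨C, rfl⟩

lemma moriCone_subset_of_cls_mem {T : Submodule ℝ≥0 (NS r)} (hT : IsClosed (T : Set (NS r)))
    (h : ∀ C : IntegralCurve r, C.cls x ∈ T) : moriCone x ⊆ T :=
  closure_minimal (Submodule.span_le.2 (Set.range_subset_iff.2 h)) hT

/-- The half-space `α^{≥ 0}`, as a cone. -/
def halfSpaceCone (α : NS r) : Submodule ℝ≥0 (NS r) where
  carrier := nonnegHalfSpace α
  zero_mem' := (inter_zero_right α).ge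
  add_mem' hβ hγ := (add_nonneg hβ hγ).trans_eq (inter_add_right α _ _).symm
  smul_mem' t β hβ := (mul_nonneg t.2 hβ).trans_eq (inter_smul_right t α β).symm

lemma isClosed_nonnegHalfSpace (α : NS r) : IsClosed (nonnegHalfSpace α) :=
  isClosed_Ici.preimage (continuous_inter α)

lemma inter_nonneg_of_forall_cls {α : NS r} (h : ∀ C : IntegralCurve r, 0 ≤ inter α (C.cls x))
    {γ : NS r} (hγ : γ ∈ moriCone x) : 0 ≤ inter α γ :=
  moriCone_subset_of_cls_mem (T := halfSpaceCone α) (isClosed_nonnegHalfSpace α) h hγ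

lemma planeClass_add (d e : ℕ) (m k : Fin r → ℕ) :
    planeClass (d + e) (m + k) = planeClass d m + planeClass e k := by
  ext i <;> simp only [planeClass, Pi.add_apply, Prod.mk_add_mk, Nat.cast_add, neg_add]

lemma planeClass_multAt_mem_effCone {F : PolyRing} (hF : F ≠ 0) {D : ℕ} (hD : F.IsHomogeneous D) :
    planeClass D (fun i => multAt (x i) F) ∈ effCone x := by
  induction F using WfDvdMonoid.induction_on_irreducible generalizing D with
  | zero => exact absurd rfl hF
  | unit u hu =>
    have hzero : planeClass D (fun i => multAt (x i) u) = 0 := by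
      ext i <;> simp [planeClass, hD.inj_right (isHomogeneous_of_isUnit hu) hF, multAt_of_isUnit,
        hu]
    exact hzero ▸ (effCone x).zero_mem
  | mul G P hG hP ih =>
    obtain ⟨k, l, rfl, hk, hl⟩ := isHomogeneous_of_mul hD hF
    have hmult : (fun i => multAt (x i) (P * G)) =
        (fun i => multAt (x i) P) + fun i => multAt (x i) G :=
      funext fun i => multAt_mul (x i) hP.ne_zero hG
    rw [hmult, planeClass_add]
    exact (effCone x).add_mem (cls_mem_effCone (.properTransform ⟨P, k, hk, hP⟩)) (ih hG hl)

lemma exceptional_sum_mem_effCone {t : Fin r → ℝ} (ht : ∀ i, 0 ≤ t i) :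
    ((0, t) : NS r) ∈ effCone x := by
  have hsum : ((0, t) : NS r) = ∑ i, t i • (IntegralCurve.exceptional i).cls x := by
    ext i <;> simp [IntegralCurve.cls, Prod.fst_sum, Prod.snd_sum, Finset.sum_apply,
      Pi.single_apply]
  rw [hsum]
  exact Submodule.sum_mem _ fun i _ => (effCone x).smul_mem ⟨t i, ht i⟩ (cls_mem_effCone _)

lemma planeClass_mem_effCone_of_mem_formsVanishing {F : PolyRing} (hF : F ≠ 0) {D : ℕ}
    {k : Fin r → ℕ} (h : F ∈ formsVanishing x D k) : planeClass D k ∈ effCone x := by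
  obtain ⟨hFD, hFk⟩ := mem_formsVanishing.1 h
  have hexc : ((0, fun i => (multAt (x i) F : ℝ) - k i) : NS r) ∈ effCone x :=
    exceptional_sum_mem_effCone fun i =>
      sub_nonneg.2 (Nat.cast_le.2 ((vanishesToOrder_iff_le_multAt hF).1 (hFk i)))
  convert (effCone x).add_mem (planeClass_multAt_mem_effCone hF hFD) hexc using 1
  ext i <;> simp [planeClass, sub_eq_add_neg]

lemma planeClass_mem_effCone_of_sum_choose_lt {D : ℕ} {k : Fin r → ℕ}
    (h : ∑ i, (k i + 1).choose 2 < (D + 2).choose 2) : planeClass D k ∈ effCone x := by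
  have hdim : 0 < Module.finrank ℂ (formsVanishing x D k) := by
    have := le_finrank_formsVanishing x D k
    lia
  obtain ⟨F, hF⟩ := Module.finrank_pos_iff_exists_ne_zero.1 hdim
  exact planeClass_mem_effCone_of_mem_formsVanishing (fun h => hF (Subtype.ext h)) F.2

lemma planeClass_mem_effCone_of_sum_sq_le {D : ℕ} {k : Fin r → ℕ} (h : ∑ i, k i ^ 2 ≤ D ^ 2) :
    planeClass (D + r) k ∈ effCone x := by
  have hk (i) : k i ≤ D := (Nat.pow_le_pow_iff_left two_ne_zero).1
    ((Finset.single_le_sum (fun j _ => Nat.zero_le (k j ^ 2)) (Finset.mem_univ i)).trans h)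
  have hsum : ∑ i, k i ≤ r * D := by
    simpa using Finset.sum_le_sum fun i (_ : i ∈ Finset.univ) => hk i
  refine planeClass_mem_effCone_of_sum_choose_lt ((Nat.cast_lt (α := ℝ)).1 ?_)
  have h' : ∑ i, (k i : ℝ) ^ 2 ≤ D ^ 2 := mod_cast h
  have hsum' : ∑ i, (k i : ℝ) ≤ r * D := mod_cast hsum
  push_cast [Nat.cast_choose_two, ← Finset.sum_div]
  calc (∑ i, ((k i : ℝ) + 1) * (k i + 1 - 1)) / 2
      = (∑ i, (k i : ℝ) ^ 2 + ∑ i, (k i : ℝ)) / 2 := by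
        rw [← Finset.sum_add_distrib]
        exact congrArg (· / 2) (Finset.sum_congr rfl fun i _ => by ring)
    _ < (D + r + 2) * (D + r + 2 - 1) / 2 := by
        nlinarith [D.cast_nonneg (α := ℝ), r.cast_nonneg (α := ℝ)]

/-- Classes `(⌈a n⌉ + r) L - ∑ i, ⌊b i n⌋ E i` are effective by a parameter count, and they
approximate `n (a L - ∑ i, b i E i)`. -/
lemma mem_moriCone_of_sum_sq_le {a : ℝ} {b : Fin r → ℝ} (ha : 0 ≤ a) (hb : ∀ i, 0 ≤ b i)
    (h : ∑ i, b i ^ 2 ≤ a ^ 2) : ((a, -b) : NS r) ∈ moriCone x := by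
  have hfst : Tendsto (fun n : ℕ => (n : ℝ)⁻¹ * (⌈a * n⌉₊ + r : ℕ)) atTop (𝓝 a) := by
    have hceil := (tendsto_nat_ceil_mul_div_atTop ha).comp tendsto_natCast_atTop_atTop
    have hr := (tendsto_inv_atTop_nhds_zero_nat (𝕜 := ℝ)).mul_const (r : ℝ)
    refine ((hceil.add hr).congr fun n => ?_).trans_eq (by rw [zero_mul, add_zero])
    simp only [Function.comp, Nat.cast_add]
    ring
  have hsnd (i) : Tendsto (fun n : ℕ => (n : ℝ)⁻¹ * -(⌊b i * n⌋₊ : ℝ)) atTop (𝓝 (-b i)) := by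
    have hfloor := (tendsto_nat_floor_mul_div_atTop (hb i)).comp tendsto_natCast_atTop_atTop
    refine hfloor.neg.congr fun n => ?_
    simp only [Function.comp]
    ring
  refine mem_closure_of_tendsto (hfst.prodMk_nhds (tendsto_pi_nhds.2 hsnd))
    (Eventually.of_forall fun n => ?_)
  refine (effCone x).smul_mem (n : ℝ≥0)⁻¹ (planeClass_mem_effCone_of_sum_sq_le ?_)
  rw [← Nat.cast_le (α := ℝ)]
  push_cast
  calc ∑ i, (⌊b i * n⌋₊ : ℝ) ^ 2 ≤ ∑ i, (b i * n) ^ 2 := by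
        gcongr with i
        exact Nat.floor_le (mul_nonneg (hb i) n.cast_nonneg)
    _ = (∑ i, b i ^ 2) * n ^ 2 := by simp only [mul_pow, Finset.sum_mul]
    _ ≤ a ^ 2 * n ^ 2 := by gcongr
    _ = (a * n) ^ 2 := (mul_pow _ _ _).symm
    _ ≤ (⌈a * n⌉₊ : ℝ) ^ 2 := by gcongr; exact Nat.le_ceil _

lemma lightCone_subset_moriCone : (lightCone r : Set (NS r)) ⊆ moriCone x := by
  rintro ⟨a, b⟩ ⟨hsq, ha⟩
  have hneg : ((a, -b⁻) : NS r) ∈ moriCone x := by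
    refine mem_moriCone_of_sum_sq_le ha (fun i => negPart_nonneg (b i)) (le_trans ?_
      (sum_sq_le_sq_of_inter_self_nonneg hsq))
    refine Finset.sum_le_sum fun i _ => sq_le_sq.2 ?_
    change |(b i)⁻| ≤ |b i|
    rw [abs_of_nonneg (negPart_nonneg (b i)), ← posPart_add_negPart (b i)]
    exact le_add_of_nonneg_left (posPart_nonneg (b i))
  have hpos : ((0, b⁺) : NS r) ∈ effCone x :=
    exceptional_sum_mem_effCone fun i => posPart_nonneg (b i)
  convert add_mem_moriCone hneg (effCone_subset_moriCone hpos) using 1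
  rw [Prod.mk_add_mk, add_zero, neg_add_eq_sub, posPart_sub_negPart]

/-- The class `(r + 1) L - ∑ i, E i`, which is ample for every choice of the points. -/
def polarization (r : ℕ) : NS r := ((r : ℝ) + 1, fun _ => -1)

lemma inter_polarization (γ : NS r) :
    inter (polarization r) γ = (r + 1) * γ.1 + ∑ i, γ.2 i := by
  simp [inter, polarization]

lemma norm_cls_le (C : IntegralCurve r) : ‖C.cls x‖ ≤ inter (polarization r) (C.cls x) := by
  rw [inter_polarization]
  rcases C with i | D
  · simp [IntegralCurve.cls, Prod.norm_def, Pi.norm_single]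
  have hm (i) : (multAt (x i) D.form : ℝ) ≤ D.degree :=
    Nat.cast_le.2 (multAt_le_of_isHomogeneous (x i) D.irreducible.ne_zero D.isHomogeneous)
  have hsum : ∑ i, (multAt (x i) D.form : ℝ) ≤ r * D.degree := by
    simpa using Finset.sum_le_sum fun i (_ : i ∈ Finset.univ) => hm i
  calc ‖(IntegralCurve.properTransform D).cls x‖ ≤ D.degree := by
        refine max_le (by simp [IntegralCurve.cls])
          ((pi_norm_le_iff_of_nonneg (Nat.cast_nonneg _)).2 fun i => ?_)
        simpa [IntegralCurve.cls] using hm i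
    _ ≤ (r + 1) * D.degree + ∑ i, -(multAt (x i) D.form : ℝ) := by
        rw [Finset.sum_neg_distrib]
        linarith

lemma norm_le_inter_polarization {γ : NS r} (hγ : γ ∈ moriCone x) :
    ‖γ‖ ≤ inter (polarization r) γ := by
  let T : Submodule ℝ≥0 (NS r) :=
    { carrier := {γ | ‖γ‖ ≤ inter (polarization r) γ}
      zero_mem' := by simp [inter_zero_right]
      add_mem' hα hβ :=
        (norm_add_le_of_le hα hβ).trans_eq (inter_add_right _ _ _).symm
      smul_mem' t α hα := by
        change ‖(t : ℝ) • α‖ ≤ inter (polarization r) ((t : ℝ) • α)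
        rw [norm_smul, NNReal.norm_eq, inter_smul_right]
        exact mul_le_mul_of_nonneg_left hα t.2 }
  exact moriCone_subset_of_cls_mem (T := T)
    (isClosed_le continuous_norm (continuous_inter _)) norm_cls_le hγ

lemma inter_polarization_nonneg {γ : NS r} (hγ : γ ∈ moriCone x) :
    0 ≤ inter (polarization r) γ := (norm_nonneg γ).trans (norm_le_inter_polarization hγ)

lemma isAmple_polarization : IsAmple x (polarization r) := fun _ hγ hγ₀ =>
  (norm_pos_iff.2 hγ₀).trans_le (norm_le_inter_polarization hγ)

lemma eq_zero_of_neg_mem_moriCone {γ : NS r} (hγ : γ ∈ moriCone x) (hγ' : -γ ∈ moriCone x) :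
    γ = 0 := by
  by_contra hγ₀
  have hneg := inter_polarization_nonneg hγ'
  rw [inter_neg_right] at hneg
  linarith [isAmple_polarization γ hγ hγ₀]

lemma quadricCone_eq_lightCone : quadricCone x = lightCone r := by
  ext α
  constructor
  · rintro ⟨hsq, h, hh, hαh⟩
    refine ⟨hsq, not_lt.1 fun hneg => ?_⟩
    have hα : -α ∈ lightCone r :=
      ⟨by rwa [inter_neg_left, inter_neg_right, neg_neg], neg_nonneg.2 hneg.le⟩
    have hpos := hh (-α) (lightCone_subset_moriCone hα)
      (neg_ne_zero.2 fun h₀ => hneg.ne (congrArg Prod.fst h₀))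
    rw [inter_neg_right, inter_comm] at hpos
    linarith
  · intro hα
    refine ⟨hα.1, polarization r, isAmple_polarization, ?_⟩
    rw [inter_comm]
    exact inter_polarization_nonneg (lightCone_subset_moriCone (x := x) hα)

end MoriCone

lemma isClosed_span_singleton_sup {E : Type*} [AddCommGroup E] [Module ℝ E] [TopologicalSpace E]
    [IsTopologicalAddGroup E] [ContinuousSMul ℝ E] {T : Submodule ℝ≥0 E}
    (hT : IsClosed (T : Set E)) {f : E →ₗ[ℝ] ℝ} (hf : Continuous f) (hfT : ∀ s ∈ T, 0 ≤ f s)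
    {c : E} (hfc : 0 < f c) :
    IsClosed ((Submodule.span ℝ≥0 {c} ⊔ T : Submodule ℝ≥0 E) : Set E) := by
  refine isClosed_of_closure_subset fun z hz => ?_
  set S : Submodule ℝ≥0 E := Submodule.span ℝ≥0 {c} ⊔ T
  have hpart : (S : Set E) ∩ {y | f y < f z + 1} ⊆
      T + (fun a : ℝ≥0 => a • c) '' Set.Icc 0 ((f z + 1) / f c).toNNReal := by
    rintro y ⟨hy, hyz⟩
    obtain ⟨b, hb, s, hs, rfl⟩ := Submodule.mem_sup.1 hy
    obtain ⟨a, rfl⟩ := Submodule.mem_span_singleton.1 hb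
    refine ⟨s, hs, a • c, ⟨a, ⟨zero_le, NNReal.le_toNNReal_of_coe_le ?_⟩, rfl⟩, add_comm _ _⟩
    rw [le_div_iff₀ hfc]
    have hlt : f (a • c + s) < f z + 1 := hyz
    rw [map_add, NNReal.smul_def, map_smul, smul_eq_mul] at hlt
    linarith [hfT s hs]
  have hclosed := hT.add_right_of_isCompact
    ((isCompact_Icc (a := 0) (b := ((f z + 1) / f c).toNNReal)).image
      (continuous_id.smul continuous_const : Continuous fun a : ℝ≥0 => a • c))
  have hzmem := (isOpen_lt hf continuous_const).closure_inter ⟨hz, lt_add_one (f z)⟩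
  obtain ⟨s, hs, _, ⟨a, -, rfl⟩, rfl⟩ := closure_minimal hpart hclosed hzmem
  exact S.add_mem (Submodule.mem_sup_right hs)
    (Submodule.mem_sup_left (Submodule.smul_mem _ a (Submodule.mem_span_singleton_self c)))

section ExtremalRays

variable {r : ℕ} {x : Fin r → Plane}

lemma cls_ne_zero (C : IntegralCurve r) : C.cls x ≠ 0 := by
  rcases C with i | D
  · intro h
    simpa [IntegralCurve.cls] using congrFun (congrArg Prod.snd h) i
  · exact fun h => (pos_of_irreducible_of_isHomogeneous D.irreducible D.isHomogeneous).ne'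
      (Nat.cast_eq_zero.1 (congrArg Prod.fst h))

lemma cls_mem_moriCone (C : IntegralCurve r) : C.cls x ∈ moriCone x :=
  effCone_subset_moriCone (cls_mem_effCone C)

lemma exists_decomposition_of_mem_moriCone (hx : Function.Injective x) (C : IntegralCurve r)
    {z : NS r} (hz : z ∈ moriCone x) :
    ∃ a : ℝ, 0 ≤ a ∧ ∃ s ∈ moriCone x, 0 ≤ inter (C.cls x) s ∧ z = a • C.cls x + s := by
  let T := (effCone x).topologicalClosure ⊓ halfSpaceCone (C.cls x)
  have hclosed := isClosed_span_singleton_sup (T := T) (f := interForm r (polarization r))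
    (isClosed_moriCone.inter (isClosed_nonnegHalfSpace _)) (continuous_inter _)
    (fun s hs => inter_polarization_nonneg hs.1)
    (isAmple_polarization _ (cls_mem_moriCone C) (cls_ne_zero (x := x) C))
  have hcls (C' : IntegralCurve r) : C'.cls x ∈ Submodule.span ℝ≥0 {C.cls x} ⊔ T := by
    rcases cls_eq_or_inter_cls_nonneg hx C C' with h | h
    · exact Submodule.mem_sup_left (h ▸ Submodule.mem_span_singleton_self _)
    · exact Submodule.mem_sup_right ⟨cls_mem_moriCone C', h⟩
  obtain ⟨b, hb, s, hs, rfl⟩ :=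
    Submodule.mem_sup.1 (moriCone_subset_of_cls_mem hclosed hcls hz)
  obtain ⟨a, rfl⟩ := Submodule.mem_span_singleton.1 hb
  exact ⟨a, a.2, s, hs.1, hs.2, rfl⟩

lemma exists_cls_of_isExtremalRay (hx : Function.Injective x) {α : NS r}
    (h : IsExtremalRay (moriCone x) (ray α)) (hα : inter α α < 0) :
    ∃ C : IntegralCurve r, ray α = ray (C.cls x) ∧ inter (C.cls x) (C.cls x) < 0 := by
  have hαx : α ∈ moriCone x := h.2.1 (mem_ray_self α)
  obtain ⟨C, hC⟩ : ∃ C : IntegralCurve r, inter α (C.cls x) < 0 := by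
    by_contra! h'
    exact hα.not_ge (inter_nonneg_of_forall_cls h' hαx)
  obtain ⟨a, ha, s, hs, hCs, hdec⟩ := exists_decomposition_of_mem_moriCone hx C hαx
  have hCC : a * inter (C.cls x) (C.cls x) < 0 := by
    rw [inter_comm, hdec, inter_add_right, inter_smul_right] at hC
    linarith
  have ha₀ : a ≠ 0 := fun h => by simp [h] at hCC
  have hmem : a • C.cls x ∈ ray α :=
    (h.2.2 _ (smul_mem_moriCone (cls_mem_moriCone C) ha) s hs (hdec ▸ mem_ray_self α)).1
  refine ⟨C, ?_, neg_of_mul_neg_right hCC ha⟩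
  rw [← ray_eq_of_mem hmem (smul_ne_zero ha₀ (cls_ne_zero C)), ray_smul (ha.lt_of_ne' ha₀)]

end ExtremalRays

/-! ### Isolated extremal rays -/

section Convex

variable {E : Type*}

lemma isCompact_convexJoin [AddCommGroup E] [Module ℝ E] [TopologicalSpace E]
    [IsTopologicalAddGroup E] [ContinuousSMul ℝ E] {P Q : Set E} (hP : IsCompact P)
    (hQ : IsCompact Q) : IsCompact (convexJoin ℝ P Q) := by
  have himage : convexJoin ℝ P Q =
      (fun z : ℝ × E × E => (1 - z.1) • z.2.1 + z.1 • z.2.2) '' (Set.Icc 0 1 ×ˢ P ×ˢ Q) := by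
    ext y
    simp only [mem_convexJoin, segment_eq_image, Set.mem_image, Set.mem_prod, Prod.exists]
    constructor
    · rintro ⟨p, hp, q, hq, t, ht, rfl⟩
      exact ⟨t, p, q, ⟨ht, hp, hq⟩, rfl⟩
    · rintro ⟨t, p, q, ⟨ht, hp, hq⟩, rfl⟩
      exact ⟨p, hp, q, hq, t, ht, rfl⟩
  rw [himage]
  exact (isCompact_Icc.prod (hP.prod hQ)).image (by fun_prop)

/-- Milman's converse to the Krein–Milman theorem: joining finitely many small balls, one at a
time, never reaches the extreme point `c`. -/
lemma exists_convex_notMem_of_mem_extremePoints [NormedAddCommGroup E] [NormedSpace ℝ E]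
    {S K : Set E} {c : E} (hS : IsCompact S) (hSc : Convex ℝ S) (hc : c ∈ S.extremePoints ℝ)
    (hK : IsCompact K) (hcK : c ∉ K) :
    ∃ P ⊆ S, IsCompact P ∧ Convex ℝ P ∧ c ∉ P ∧ K ∩ S ⊆ P := by
  refine hK.induction_on
    (p := fun T => ∃ P ⊆ S, IsCompact P ∧ Convex ℝ P ∧ c ∉ P ∧ T ∩ S ⊆ P) ?_ ?_ ?_ ?_
  · exact ⟨∅, S.empty_subset, isCompact_empty, convex_empty, id, by simp⟩
  · rintro T T' hTT' ⟨P, hPS, hP, hPc, hcP, hT'P⟩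
    exact ⟨P, hPS, hP, hPc, hcP, (Set.inter_subset_inter_left S hTT').trans hT'P⟩
  · rintro T T' ⟨P, hPS, hP, hPc, hcP, hTP⟩ ⟨P', hPS', hP', hPc', hcP', hTP'⟩
    rw [Set.union_inter_distrib_right]
    rcases P.eq_empty_or_nonempty with rfl | hPne
    · exact ⟨P', hPS', hP', hPc', hcP', Set.union_subset (hTP.trans P'.empty_subset) hTP'⟩
    rcases P'.eq_empty_or_nonempty with rfl | hPne'
    · exact ⟨P, hPS, hP, hPc, hcP, Set.union_subset hTP (hTP'.trans P.empty_subset)⟩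
    refine ⟨convexJoin ℝ P P', convexJoin_subset hPS hPS' hSc, isCompact_convexJoin hP hP',
      hPc.convexJoin hPc', fun hcJ => ?_,
      Set.union_subset (hTP.trans (subset_convexJoin_left hPne'))
        (hTP'.trans (subset_convexJoin_right hPne))⟩
    obtain ⟨p, hp, q, hq, hpq⟩ := mem_convexJoin.1 hcJ
    rcases (mem_extremePoints_iff_forall_segment.1 hc).2 p (hPS hp) q (hPS' hq) hpq with rfl | rfl
    · exact hcP hp
    · exact hcP' hq
  · intro y hy
    have hdist : 0 < dist c y := dist_pos.2 fun h => hcK (h ▸ hy)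
    refine ⟨Metric.closedBall y (dist c y / 2),
      mem_nhdsWithin_of_mem_nhds (Metric.closedBall_mem_nhds y (half_pos hdist)),
      Metric.closedBall y (dist c y / 2) ∩ S, Set.inter_subset_right,
      hS.inter_left Metric.isClosed_closedBall, (convex_closedBall _ _).inter hSc,
      fun hcB => ?_, subset_rfl⟩
    linarith [Metric.mem_closedBall.1 hcB.1]

end Convex

section Isolated

variable {r : ℕ} {x : Fin r → Plane}

/-- The classes in the Mori cone of degree one with respect to the polarization: a compact base of
the Mori cone. -/
def moriSlice (x : Fin r → Plane) : Set (NS r) :=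
  {γ | γ ∈ moriCone x ∧ inter (polarization r) γ = 1}

lemma isCompact_moriSlice : IsCompact (moriSlice x) := by
  refine Metric.isCompact_of_isClosed_isBounded
    (isClosed_moriCone.inter (isClosed_eq (continuous_inter _) continuous_const))
    (isBounded_iff_forall_norm_le.2 ⟨1, fun γ hγ => ?_⟩)
  exact (norm_le_inter_polarization hγ.1).trans hγ.2.le

lemma convex_moriSlice : Convex ℝ (moriSlice x) := by
  intro α hα β hβ a b ha hb hab
  refine ⟨add_mem_moriCone (smul_mem_moriCone hα.1 ha) (smul_mem_moriCone hβ.1 hb), ?_⟩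
  rw [inter_add_right, inter_smul_right, inter_smul_right, hα.2, hβ.2, mul_one, mul_one, hab]

lemma exists_smul_mem_moriSlice {γ : NS r} (hγ : γ ∈ moriCone x) (hγ₀ : γ ≠ 0) :
    ∃ t : ℝ, 0 < t ∧ ∃ e ∈ moriSlice x, γ = t • e := by
  have hpos := isAmple_polarization γ hγ hγ₀
  refine ⟨_, hpos, _, ⟨smul_mem_moriCone hγ (inv_pos.2 hpos).le, ?_⟩,
    (smul_inv_smul₀ hpos.ne' γ).symm⟩
  rw [inter_smul_right, inv_mul_cancel₀ hpos.ne']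

lemma ne_zero_of_mem_moriSlice {e : NS r} (he : e ∈ moriSlice x) : e ≠ 0 := by
  rintro rfl
  exact zero_ne_one ((inter_zero_right _).symm.trans he.2)

lemma eq_of_mem_ray {c e : NS r} (hc : c ∈ moriSlice x) (he : e ∈ moriSlice x) (h : e ∈ ray c) :
    e = c := by
  obtain ⟨t, -, rfl⟩ := h
  have ht₁ := he.2
  rw [inter_smul_right, hc.2, mul_one] at ht₁
  rw [ht₁, one_smul]

lemma isExtremalRay_of_mem_extremePoints {e : NS r} (he : e ∈ (moriSlice x).extremePoints ℝ) :
    IsExtremalRay (moriCone x) (ray e) := by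
  refine ⟨⟨e, ne_zero_of_mem_moriSlice he.1, rfl⟩, ?_, ?_⟩
  · rintro _ ⟨t, ht, rfl⟩
    exact smul_mem_moriCone he.1.1 ht
  rintro β hβ γ hγ ⟨t, ht, hsum⟩
  rcases eq_or_ne β 0 with rfl | hβ₀
  · exact ⟨⟨0, le_rfl, (zero_smul ℝ e).symm⟩, t, ht, (zero_add γ).symm.trans hsum⟩
  rcases eq_or_ne γ 0 with rfl | hγ₀
  · exact ⟨⟨t, ht, (add_zero β).symm.trans hsum⟩, 0, le_rfl, (zero_smul ℝ e).symm⟩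
  obtain ⟨a, ha, β', hβ', rfl⟩ := exists_smul_mem_moriSlice hβ hβ₀
  obtain ⟨b, hb, γ', hγ', rfl⟩ := exists_smul_mem_moriSlice hγ hγ₀
  obtain rfl : a + b = t := by
    have hdeg := congrArg (inter (polarization r)) hsum
    simpa only [inter_add_right, inter_smul_right, hβ'.2, hγ'.2, he.1.2, mul_one] using hdeg
  have hab := add_pos ha hb
  have hmem : e ∈ openSegment ℝ β' γ' := by
    refine ⟨a / (a + b), b / (a + b), div_pos ha hab, div_pos hb hab, ?_, ?_⟩
    · rw [← add_div, div_self hab.ne']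
    · rw [div_eq_inv_mul, div_eq_inv_mul, mul_smul, mul_smul, ← smul_add, hsum,
        inv_smul_smul₀ hab.ne']
  obtain ⟨rfl, rfl⟩ := (mem_extremePoints.1 he).2 β' hβ' γ' hγ' hmem
  exact ⟨⟨a, ha.le, rfl⟩, b, hb.le, rfl⟩

lemma mem_extremePoints_of_isExtremalRay {e : NS r} (h : IsExtremalRay (moriCone x) (ray e))
    (he : e ∈ moriSlice x) : e ∈ (moriSlice x).extremePoints ℝ := by
  refine mem_extremePoints_iff_left.2 ⟨he, ?_⟩
  rintro β hβ γ hγ ⟨a, b, ha, hb, -, hsum⟩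
  obtain ⟨t, ht, hβe⟩ := (h.2.2 _ (smul_mem_moriCone hβ.1 ha.le) _ (smul_mem_moriCone hγ.1 hb.le)
    (hsum ▸ mem_ray_self e)).1
  refine eq_of_mem_ray he hβ ⟨a⁻¹ * t, mul_nonneg (inv_pos.2 ha).le ht, ?_⟩
  rw [mul_smul, ← hβe, inv_smul_smul₀ ha.ne']

lemma moriCone_subset_of_extremePoints_subset {T : Submodule ℝ≥0 (NS r)}
    (hT : IsClosed (T : Set (NS r))) (h : (moriSlice x).extremePoints ℝ ⊆ T) : moriCone x ⊆ T := by
  have hTc : Convex ℝ (T : Set (NS r)) := fun α hα β hβ a b ha hb _ =>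
    T.add_mem (T.smul_mem ⟨a, ha⟩ hα) (T.smul_mem ⟨b, hb⟩ hβ)
  have hslice : moriSlice x ⊆ T := by
    rw [← closure_convexHull_extremePoints isCompact_moriSlice convex_moriSlice]
    exact closure_minimal (convexHull_min h hTc) hT
  intro γ hγ
  rcases eq_or_ne γ 0 with rfl | hγ₀
  · exact T.zero_mem
  obtain ⟨t, ht, e, he, rfl⟩ := exists_smul_mem_moriSlice hγ hγ₀
  exact T.smul_mem ⟨t, ht.le⟩ (hslice he)

lemma exists_linear_of_isIsolatedExtremalRay {c : NS r} (hc : c ∈ moriSlice x)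
    (h : IsIsolatedExtremalRay (moriCone x) (ray c)) :
    ∃ ψ : NS r →ₗ[ℝ] ℝ, ψ c < 0 ∧ ∀ γ ∈ moriCone x,
      ∃ a : ℝ, ∃ t ∈ moriCone x, 0 ≤ ψ t ∧ γ = a • c + t := by
  obtain ⟨hext, _, ⟨τ, hτ, rfl⟩, -, U, hU, hτU, hiso⟩ := h
  have hU' : IsOpen ((τ • ·) ⁻¹' U : Set (NS r)) := hU.preimage (continuous_const_smul τ)
  obtain ⟨P, -, hP, hPc, hcP, hUP⟩ := exists_convex_notMem_of_mem_extremePoints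
    isCompact_moriSlice convex_moriSlice (mem_extremePoints_of_isExtremalRay hext hc)
    (isCompact_moriSlice.diff hU') fun h => h.2 hτU
  obtain ⟨f, u, hfc, hfP⟩ := geometric_hahn_banach_point_closed hPc hP.isClosed hcP
  let ψ : NS r →ₗ[ℝ] ℝ := f - u • interForm r (polarization r)
  have hψ {e : NS r} (he : e ∈ moriSlice x) : ψ e = f e - u := by
    simp [ψ, interForm_apply, he.2]
  have hψcont : Continuous ψ := ψ.continuous_of_finiteDimensional
  let T : Submodule ℝ≥0 (NS r) := (effCone x).topologicalClosure ⊓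
    (PointedCone.positive ℝ ℝ).comap ψ
  have hclosed : IsClosed ((Submodule.span ℝ≥0 {c} ⊔ T : Submodule ℝ≥0 (NS r)) : Set (NS r)) :=
    isClosed_span_singleton_sup (T := T) (f := interForm r (polarization r))
      (isClosed_moriCone.inter (isClosed_le continuous_const hψcont)) (continuous_inter _)
      (fun t ht => inter_polarization_nonneg ht.1)
      (isAmple_polarization c hc.1 (ne_zero_of_mem_moriSlice hc))
  have hextreme : (moriSlice x).extremePoints ℝ ⊆ (Submodule.span ℝ≥0 {c} ⊔ T :) := by
    intro e he
    by_cases heU : τ • e ∈ U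
    · obtain rfl : e = c := by
        refine eq_of_mem_ray hc he.1 ?_
        rw [← hiso _ (isExtremalRay_of_mem_extremePoints he) ⟨_, ⟨τ, hτ, rfl⟩, heU⟩]
        exact mem_ray_self e
      exact Submodule.mem_sup_left (Submodule.mem_span_singleton_self e)
    · refine Submodule.mem_sup_right ⟨he.1.1, ?_⟩
      have heP := hfP e (hUP ⟨⟨he.1, heU⟩, he.1⟩)
      exact (sub_nonneg.2 heP.le).trans_eq (hψ he.1).symm
  refine ⟨ψ, (hψ hc).trans_lt (sub_neg.2 hfc), fun γ hγ => ?_⟩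
  obtain ⟨b, hb, t, ht, rfl⟩ :=
    Submodule.mem_sup.1 (moriCone_subset_of_extremePoints_subset hclosed hextreme hγ)
  obtain ⟨a, rfl⟩ := Submodule.mem_span_singleton.1 hb
  exact ⟨a, t, ht.1, ht.2, rfl⟩

lemma exists_add_mem_lightCone {c w : NS r} (hc : c ∈ lightCone r) (hc₀ : c ≠ 0)
    (hw : inter c w = 0) (hw₁ : w.1 = 0) :
    ∃ u : NS r, ∀ ε : ℝ, c + ε • w + ε ^ 2 • u ∈ lightCone r := by
  have hc₁ := fst_pos_of_mem_lightCone hc hc₀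
  have hww : inter w w ≤ 0 := by
    rw [inter, hw₁, mul_zero, zero_sub, neg_nonpos]
    exact Finset.sum_nonneg fun i _ => mul_self_nonneg _
  obtain ⟨s, hs⟩ : ∃ s, s * c.1 = -inter w w := ⟨_, div_mul_cancel₀ _ hc₁.ne'⟩
  have hs₀ : 0 ≤ s := nonneg_of_mul_nonneg_left (hs ▸ neg_nonneg.2 hww) hc₁
  have hfst (ε : ℝ) : (c + ε • w + ε ^ 2 • (s, 0)).1 = c.1 + ε ^ 2 * s := by simp [hw₁]
  refine ⟨(s, 0), fun ε => ⟨?_, ?_⟩⟩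
  · have hu (v : NS r) : inter v (s, 0) = v.1 * s := by simp [inter]
    have hu' (v : NS r) : inter (s, 0) v = v.1 * s := by rw [inter_comm, hu]
    have hsq : inter (c + ε • w + ε ^ 2 • (s, 0)) (c + ε • w + ε ^ 2 • (s, 0)) =
        inter c c + ε ^ 2 * (2 * (s * c.1) + inter w w) + (ε ^ 2 * s) ^ 2 := by
      simp only [inter_add_left, inter_add_right, inter_smul_left, inter_smul_right, hu,
        hu', inter_comm w c, hw, hw₁, hfst]
      ring
    rw [hsq, hs]
    nlinarith [hc.1, sq_nonneg (ε ^ 2 * s), mul_nonneg (sq_nonneg ε) (neg_nonneg.2 hww)]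
  · rw [hfst]
    positivity

lemma mem_moriCone_of_forall_add_smul_mem {v u : NS r}
    (h : ∀ ε : ℝ, 0 < ε → v + ε • u ∈ moriCone x) : v ∈ moriCone x := by
  have hlim : Tendsto (fun ε : ℝ => v + ε • u) (𝓝[>] 0) (𝓝 v) := by
    refine (Continuous.tendsto' (by fun_prop) 0 v ?_).mono_left nhdsWithin_le_nhds
    rw [zero_smul, add_zero]
  exact isClosed_moriCone.mem_of_tendsto hlim (eventually_mem_nhdsWithin.mono h)

lemma mem_moriCone_of_forall_curve_mem {c w u : NS r} {ψ : NS r →ₗ[ℝ] ℝ} (hc : c ∈ moriCone x)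
    (hψc : ψ c < 0)
    (hψ : ∀ γ ∈ moriCone x, ∃ a : ℝ, ∃ t ∈ moriCone x, 0 ≤ ψ t ∧ γ = a • c + t)
    (hw : ψ w = 0) (h : ∀ ε : ℝ, 0 < ε → c + ε • w + ε ^ 2 • u ∈ moriCone x) :
    w ∈ moriCone x := by
  obtain ⟨M, hM⟩ : ∃ M, M * -ψ c = ψ u := ⟨_, div_mul_cancel₀ _ (neg_pos.2 hψc).ne'⟩
  refine mem_moriCone_of_forall_add_smul_mem (u := u + M • c) fun ε hε => ?_
  obtain ⟨a, t, ht, hψt, heq⟩ := hψ _ (h ε hε)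
  have hcoeff : 0 ≤ M * ε ^ 2 - (1 - a) := by
    have hψeq := congrArg ψ heq
    simp only [map_add, map_smul, hw, smul_eq_mul, mul_zero, add_zero] at hψeq
    refine nonneg_of_mul_nonneg_left (b := -ψ c) ?_ (neg_pos.2 hψc)
    linear_combination hψt - ε ^ 2 * hM - hψeq
  have hmem : ε⁻¹ • (t + (M * ε ^ 2 - (1 - a)) • c) ∈ moriCone x :=
    smul_mem_moriCone (add_mem_moriCone ht (smul_mem_moriCone hc hcoeff)) (inv_pos.2 hε).le
  rw [← sub_eq_iff_eq_add'] at heq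
  convert hmem using 1
  rw [← heq]
  match_scalars <;> field_simp
  ring

/-- A ray of the light cone has too many tangent directions: those in the kernel of the functional
that isolates it would give a line in the Mori cone. -/
lemma inter_self_neg_of_isIsolatedExtremalRay (hr : 3 ≤ r) {α : NS r}
    (h : IsIsolatedExtremalRay (moriCone x) (ray α)) (hα : 0 ≤ α.1) (hα₀ : α ≠ 0) :
    inter α α < 0 := by
  by_contra! hsq
  obtain ⟨t, ht, c, hc, rfl⟩ := exists_smul_mem_moriSlice (h.1.2.1 (mem_ray_self α)) hα₀
  rw [ray_smul ht] at h
  have hcQ : c ∈ lightCone r := by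
    rw [inter_smul_left, inter_smul_right, ← mul_assoc] at hsq
    exact ⟨nonneg_of_mul_nonneg_right hsq (mul_pos ht ht), nonneg_of_mul_nonneg_right hα ht⟩
  have hc₀ := ne_zero_of_mem_moriSlice hc
  obtain ⟨ψ, hψc, hψ⟩ := exists_linear_of_isIsolatedExtremalRay hc h
  have hker : ((interForm r c).prod (ψ.prod (LinearMap.fst ℝ ℝ (Fin r → ℝ)))).ker ≠ ⊥ := by
    apply LinearMap.ker_ne_bot_of_finrank_lt
    simp
    lia
  obtain ⟨w, hw, hw₀⟩ := (Submodule.ne_bot_iff _).1 hker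
  obtain ⟨hcw, hψw, hw₁⟩ : inter c w = 0 ∧ ψ w = 0 ∧ w.1 = 0 := by
    simpa only [LinearMap.mem_ker, LinearMap.prod_apply, Function.prod, Prod.mk_eq_zero,
      interForm_apply, LinearMap.fst_apply] using hw
  obtain ⟨u, hu⟩ := exists_add_mem_lightCone hcQ hc₀ hcw hw₁
  have hcurve (ε : ℝ) : c + ε • w + ε ^ 2 • u ∈ moriCone x := lightCone_subset_moriCone (hu ε)
  refine hw₀ (eq_zero_of_neg_mem_moriCone (x := x)
    (mem_moriCone_of_forall_curve_mem hc.1 hψc hψ hψw fun ε _ => hcurve ε)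
    (mem_moriCone_of_forall_curve_mem (u := u) hc.1 hψc hψ (by simp [hψw]) fun ε _ => ?_))
  simpa only [smul_neg, neg_smul, neg_sq] using hcurve (-ε)

end Isolated

/-! ### `(-1)`-rays and the quadric cone -/

section Rays

variable {r : ℕ} {x : Fin r → Plane} {c M : NS r}

lemma notMem_intrinsicInterior_of_isMinOn {E : Type*} [NormedAddCommGroup E] [NormedSpace ℝ E]
    {V : Set E} {f : E →ₗ[ℝ] ℝ} {z v : E} (hz : IsMinOn f V z) (hv : v ∈ V) (hzv : f z < f v) :
    z ∉ intrinsicInterior ℝ V := by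
  intro hzi
  obtain ⟨y, hy, rfl⟩ := mem_intrinsicInterior.1 hzi
  let γ : ℝ → affineSpan ℝ V := fun ε =>
    ⟨AffineMap.lineMap (y : E) v ε, AffineMap.lineMap_mem ε y.2 (subset_affineSpan ℝ V hv)⟩
  have hγ : Tendsto γ (𝓝[<] 0) (𝓝 y) := by
    refine (Continuous.tendsto' ?_ 0 y (Subtype.ext (AffineMap.lineMap_apply_zero _ _))).mono_left
      nhdsWithin_le_nhds
    exact AffineMap.lineMap_continuous.subtype_mk _
  obtain ⟨ε, hεV, hε⟩ := ((hγ.eventually (mem_interior_iff_mem_nhds.1 hy)).and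
    eventually_mem_nhdsWithin).exists
  have hmin : f y ≤ f (AffineMap.lineMap (y : E) v ε) := hz hεV
  rw [AffineMap.lineMap_apply_module', map_add, map_smul, map_sub, smul_eq_mul] at hmin
  linarith [mul_neg_of_neg_of_pos hε (sub_pos.2 hzv)]

lemma fst_nonneg_of_mem_moriCone {γ : NS r} (hγ : γ ∈ moriCone x) : 0 ≤ γ.1 := by
  have hline (δ : NS r) : inter (1, 0) δ = δ.1 := by simp [inter]
  rw [← hline]
  refine inter_nonneg_of_forall_cls (x := x) (fun C => ?_) hγ
  rw [hline]
  rcases C with _ | _ <;> simp [IntegralCurve.cls]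

/-- The classes of `(-1)`-curves: the integral curves `C` with `C² = K · C = -1`. -/
def IsMinusOneClass (x : Fin r → Plane) (c : NS r) : Prop :=
  (∃ C : IntegralCurve r, c = C.cls x) ∧ inter c c = -1 ∧ inter (canonicalClass r) c = -1

lemma IsMinusOneClass.fst_nonneg (hc : IsMinusOneClass x c) : 0 ≤ c.1 := by
  obtain ⟨⟨C, rfl⟩, -⟩ := hc
  exact fst_nonneg_of_mem_moriCone (cls_mem_moriCone C)

lemma IsMinusOneClass.fst_canonicalClass_lt (hc : IsMinusOneClass x c) :
    (canonicalClass r).1 < c.1 :=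
  (neg_neg_of_pos zero_lt_three).trans_le hc.fst_nonneg

lemma IsMinusOneRay.exists_isMinusOneClass (hr : 3 ≤ r) (hx : Function.Injective x)
    {R : Set (NS r)} (hR : IsMinusOneRay x R) : ∃ c, IsMinusOneClass x c ∧ R = ray c := by
  obtain ⟨hiso, C, rfl, hKC⟩ := hR
  have hCC := inter_self_neg_of_isIsolatedExtremalRay hr hiso
    (fst_nonneg_of_mem_moriCone (cls_mem_moriCone C)) (cls_ne_zero C)
  exact ⟨_, ⟨⟨C, rfl⟩, inter_self_and_inter_canonicalClass_of_neg hx C hCC hKC⟩, rfl⟩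

lemma IsKNegativeExtremalRay.subset_lightCone_or_exists (hx : Function.Injective x)
    {R : Set (NS r)} (hR : IsKNegativeExtremalRay x R) :
    R ⊆ lightCone r ∨ ∃ c, IsMinusOneClass x c ∧ R = ray c := by
  obtain ⟨hext, hK⟩ := hR
  obtain ⟨α, -, rfl⟩ := hext.1
  rcases le_or_gt 0 (inter α α) with hαα | hαα
  · left
    rw [ray_eq_span, SetLike.coe_subset_coe, Submodule.span_singleton_le_iff_mem]
    exact ⟨hαα, fst_nonneg_of_mem_moriCone (hext.2.1 (mem_ray_self α))⟩
  · right
    obtain ⟨C, hC, hCC⟩ := exists_cls_of_isExtremalRay hx hext hαα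
    have hKC := hK (C.cls x) (hC ▸ mem_ray_self _) (cls_ne_zero C)
    exact ⟨_, ⟨⟨C, rfl⟩, inter_self_and_inter_canonicalClass_of_neg hx C hCC hKC⟩, hC⟩

lemma quadricCone_add_ray (x : Fin r → Plane) (M : NS r) :
    quadricCone x + ray M = (lightCone r ⊔ Submodule.span ℝ≥0 {M} : Submodule ℝ≥0 (NS r)) := by
  rw [quadricCone_eq_lightCone, ray_eq_span, Submodule.coe_sup]

lemma mem_quadricCone_add_ray (h : c - M ∈ lightCone r) :
    c ∈ lightCone r ⊔ Submodule.span ℝ≥0 {M} :=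
  Submodule.mem_sup.2 ⟨_, h, M, Submodule.mem_span_singleton_self M, sub_add_cancel c M⟩

lemma ray_subset_quadricCone_add_ray (h : c - M ∈ lightCone r) :
    ray c ⊆ quadricCone x + ray M := by
  rw [quadricCone_add_ray, ray_eq_span, SetLike.coe_subset_coe,
    Submodule.span_singleton_le_iff_mem]
  exact mem_quadricCone_add_ray h

lemma moriCone_subset_quadricCone_add_ray (hx : Function.Injective x)
    (hM : ∀ c, IsMinusOneClass x c → c - M ∈ lightCone r) (hconj : MinusOneCurvesConjecture x) :
    moriCone x ⊆ quadricCone x + ray M := by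
  rw [MinusOneCurvesConjecture, quadricCone_eq_lightCone, ← Submodule.coe_sup] at hconj
  rw [hconj, quadricCone_add_ray, SetLike.coe_subset_coe]
  refine sup_le le_sup_left (Submodule.span_le.2 (Set.sUnion_subset fun R hR => ?_))
  rcases IsKNegativeExtremalRay.subset_lightCone_or_exists hx hR with hRQ | ⟨c, hc, rfl⟩
  · exact hRQ.trans (SetLike.coe_subset_coe.2 le_sup_left)
  · rw [← quadricCone_add_ray x]
    exact ray_subset_quadricCone_add_ray (hM c hc)

/-- For `β = q + t M` one has `β² = q² + 2 t (M · β) - t² M²`, and all three terms are nonnegative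
when `M · β ≥ 0`. -/
lemma moriCone_inter_nonnegHalfSpace (hx : Function.Injective x) (hMM : inter M M ≤ 0)
    (hM : ∀ c, IsMinusOneClass x c → c - M ∈ lightCone r) (hconj : MinusOneCurvesConjecture x) :
    moriCone x ∩ nonnegHalfSpace M = quadricCone x ∩ nonnegHalfSpace M := by
  refine Set.Subset.antisymm ?_ (Set.inter_subset_inter_left _ ?_)
  · rintro β ⟨hβ, hβM⟩
    refine ⟨?_, hβM⟩
    obtain ⟨q, hq, _, ⟨t, ht, rfl⟩, rfl⟩ := moriCone_subset_quadricCone_add_ray hx hM hconj hβ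
    rw [quadricCone_eq_lightCone] at hq ⊢
    refine ⟨?_, fst_nonneg_of_mem_moriCone hβ⟩
    have hqM : 0 ≤ inter M q + t * inter M M := by
      rw [← inter_smul_right, ← inter_add_right]
      exact hβM
    simp only [inter_add_left, inter_add_right, inter_smul_left, inter_smul_right,
      inter_comm q M]
    nlinarith [hq.1, mul_nonneg ht hqM, mul_nonneg (mul_nonneg ht ht) (neg_nonneg.2 hMM)]
  · rw [quadricCone_eq_lightCone]
    exact lightCone_subset_moriCone

lemma sub_mem_lightCone (hcc : -1 ≤ inter c c) (hMM : -1 ≤ inter M M) (hMc : inter M c ≤ -1)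
    (hle : M.1 ≤ c.1) : c - M ∈ lightCone r := by
  refine ⟨?_, sub_nonneg.2 hle⟩
  rw [inter_sub_left, inter_sub_right, inter_sub_right, inter_comm c M]
  linarith

lemma ray_subset_coneBoundary (hcc : inter c c = -1) (hMM : inter M M = -1)
    (hMc : inter M c = -1) (hlt : M.1 < c.1) :
    ray c ⊆ coneBoundary (quadricCone x + ray M) := by
  have hcM : c - M ∈ lightCone r := sub_mem_lightCone hcc.ge hMM.ge hMc.le hlt.le
  rintro _ ⟨t, ht, rfl⟩
  refine ⟨ray_subset_quadricCone_add_ray hcM ⟨t, ht, rfl⟩, ?_⟩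
  have hc : interForm r (c - M) (t • c) = 0 := by
    rw [map_smul, interForm_apply, inter_sub_left, hcc, hMc, sub_self, smul_zero]
  have hM : inter (c - M) M = 0 := by rw [inter_sub_left, inter_comm c M, hMc, hMM, sub_self]
  refine notMem_intrinsicInterior_of_isMinOn (f := interForm r (c - M)) (v := (1, 0)) ?_ ?_ ?_
  · rintro _ ⟨q, hq, _, ⟨u, -, rfl⟩, rfl⟩
    rw [quadricCone_eq_lightCone] at hq
    have hq₀ : 0 ≤ inter (c - M) (q + u • M) := by
      rw [inter_add_right, inter_smul_right, hM, mul_zero, add_zero]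
      exact inter_nonneg_of_mem_lightCone hcM hq
    exact hc.trans_le hq₀
  · rw [quadricCone_add_ray]
    exact Submodule.mem_sup_left (mem_lightCone.2 (by simp [inter]))
  · rw [hc, interForm_apply]
    simpa [inter] using hlt

lemma disjoint_ray_quadricCone_add_ray (hcc : inter c c = -1) (hMM : inter M M < -1)
    (hMc : inter M c = -1) : Disjoint (ray c \ {0}) (quadricCone x + ray M) := by
  rw [Set.disjoint_left]
  rintro _ ⟨⟨t, ht, rfl⟩, htc⟩ ⟨q, hq, _, ⟨u, hu, rfl⟩, heq⟩
  obtain rfl : q = t • c - u • M := eq_sub_of_add_eq heq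
  have ht₀ : 0 < t := ht.lt_of_ne' fun h => htc (by rw [h, zero_smul]; rfl)
  have hqq : 0 ≤ -(t - u) ^ 2 + u ^ 2 * (inter M M + 1) := by
    convert hq.1 using 1
    simp only [inter_sub_left, inter_sub_right, inter_smul_left, inter_smul_right, hcc, hMc,
      inter_comm c M]
    ring
  rcases hu.eq_or_lt with rfl | hu
  · nlinarith
  · nlinarith [sq_nonneg (t - u), mul_pos hu hu]

end Rays

section CanonicalClass

variable {r : ℕ} {x : Fin r → Plane} {L : NS r}

lemma inter_canonicalClass_self (r : ℕ) :
    inter (canonicalClass r) (canonicalClass r) = 9 - r := by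
  simp [inter, canonicalClass]
  norm_num

namespace IsLinePullback

lemma inter_self (hL : IsLinePullback x L) (hx : Function.Injective x) : inter L L = 1 := by
  obtain ⟨d, m, F, hF, rfl⟩ := hL
  refine (inter_planeClass d d m m).trans (sub_eq_of_eq_add' ?_)
  rw [← sq, (hF.numerics hx).1]
  push_cast
  simp only [sq]

lemma inter_canonicalClass (hL : IsLinePullback x L) (hx : Function.Injective x) :
    inter (canonicalClass r) L = -3 := by
  obtain ⟨d, m, F, hF, rfl⟩ := hL
  refine (inter_canonicalClass_planeClass d m).trans ?_
  rw [(hF.numerics hx).2]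
  push_cast
  ring

lemma fst_nonneg (hL : IsLinePullback x L) : 0 ≤ L.1 := by
  obtain ⟨d, m, F, -, rfl⟩ := hL
  exact Nat.cast_nonneg d

lemma inter_cls_nonneg (hL : IsLinePullback x L) (hx : Function.Injective x)
    (C : IntegralCurve r) : 0 ≤ inter L (C.cls x) := by
  obtain ⟨d, m, F, hF, rfl⟩ := hL
  rcases C with i | D
  · rw [inter_cls_exceptional, neg_neg]
    exact Nat.cast_nonneg (m i)
  · obtain ⟨j, hj⟩ := hF.exists_not_dvd D.irreducible
    rw [inter_comm, cls_properTransform]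
    refine (sub_nonneg.2 ?_).trans_eq (inter_planeClass _ _ _ _).symm
    exact_mod_cast D.sum_multAt_mul_le hx (hF.form_mem_formsVanishing j) hj

lemma inter_canonicalClass_sub_smul_self (hL : IsLinePullback x L) (hx : Function.Injective x)
    (s : ℝ) :
    inter (canonicalClass r - s • L) (canonicalClass r - s • L) = (s + 3) ^ 2 - r := by
  simp only [inter_sub_left, inter_sub_right, inter_smul_left, inter_smul_right,
    inter_canonicalClass_self, hL.inter_self hx, inter_comm L (canonicalClass r),
    hL.inter_canonicalClass hx]
  ring

lemma sub_mem_lightCone (hL : IsLinePullback x L) (hx : Function.Injective x) {s : ℝ}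
    (hs : 0 ≤ s) (hsr : r - 1 ≤ (s + 3) ^ 2) {c : NS r} (hc : IsMinusOneClass x c) :
    c - (canonicalClass r - s • L) ∈ lightCone r := by
  refine BlowUpPlane.sub_mem_lightCone hc.2.1.ge ?_ ?_ ?_
  · rw [hL.inter_canonicalClass_sub_smul_self hx]
    linarith
  · obtain ⟨C, rfl⟩ := hc.1
    rw [inter_sub_left, inter_smul_left, hc.2.2]
    linarith [mul_nonneg hs (hL.inter_cls_nonneg hx C)]
  · have hfst : (canonicalClass r - s • L).1 = -3 - s * L.1 := rfl
    linarith [mul_nonneg hs hL.fst_nonneg, hc.fst_nonneg]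

end IsLinePullback

lemma exists_isotropic_of_ten_lt (hr : 10 < r) (i : Fin r) :
    ∃ q ∈ lightCone r, inter q q = 0 ∧ q.2 i = 0 ∧ 0 < inter (canonicalClass r) q := by
  have hr₀ : (11 : ℝ) ≤ r := mod_cast hr
  have hsq : √((r : ℝ) - 1) ^ 2 = r - 1 := Real.sq_sqrt (by linarith)
  have hsqrt : 3 < √((r : ℝ) - 1) := Real.lt_sqrt_of_sq_lt (by linarith)
  have hsum (t : ℝ) : ∑ j, (if j = i then 0 else t) = (r - 1) * t := by
    rw [← Finset.sum_erase_add _ _ (Finset.mem_univ i), if_pos rfl, add_zero,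
      Finset.sum_congr rfl fun j hj => if_neg (Finset.ne_of_mem_erase hj), Finset.sum_const,
      Finset.card_erase_of_mem (Finset.mem_univ i), Finset.card_fin, nsmul_eq_mul,
      Nat.cast_pred (by lia)]
  let q : NS r := (√((r : ℝ) - 1), fun j => if j = i then 0 else -1)
  have hqq : inter q q = 0 := by
    have hmul (j : Fin r) : (if j = i then (0 : ℝ) else -1) * (if j = i then 0 else -1) =
        if j = i then 0 else 1 := by split_ifs <;> norm_num
    simp only [inter, q, hmul, hsum]
    linarith
  refine ⟨q, ⟨hqq.ge, Real.sqrt_nonneg _⟩, hqq, if_pos rfl, ?_⟩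
  rw [inter_canonicalClass, hsum]
  nlinarith

lemma quadricCone_inter_ssubset_moriCone_inter (hr : 10 < r) :
    quadricCone x ∩ nonnegHalfSpace (canonicalClass r) ⊂
      moriCone x ∩ nonnegHalfSpace (canonicalClass r) := by
  rw [quadricCone_eq_lightCone]
  refine ⟨Set.inter_subset_inter_left _ lightCone_subset_moriCone, fun hsub => ?_⟩
  let i : Fin r := ⟨0, by lia⟩
  obtain ⟨q, hq, hqq, hqi, hKq⟩ := exists_isotropic_of_ten_lt hr i
  set k := inter (canonicalClass r) q
  let e : NS r := (IntegralCurve.exceptional i).cls x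
  have hqe : inter q e = 0 := by rw [inter_cls_exceptional, hqi, neg_zero]
  have hee : inter e e = -1 := by rw [inter_cls_exceptional]; simp [e, IntegralCurve.cls]
  have hmori : q + k • e ∈ moriCone x := add_mem_moriCone (lightCone_subset_moriCone hq)
    (smul_mem_moriCone (cls_mem_moriCone _) hKq.le)
  have hK : 0 ≤ inter (canonicalClass r) (q + k • e) := by
    rw [inter_add_right, inter_smul_right, inter_cls_exceptional]
    simp [k, canonicalClass]
  have hsq := (hsub ⟨hmori, hK⟩).1.1
  simp only [inter_add_left, inter_add_right, inter_smul_left, inter_smul_right, hqq, hqe, hee,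
    inter_comm e q] at hsq
  nlinarith [mul_pos hKq hKq]

end CanonicalClass

end BlowUpPlane

end

open BlowUpPlane in
theorem mainTheorem2 (r : ℕ) (hr : 10 ≤ r) (x : Fin r → Plane) (hx : Function.Injective x) :
    (∀ L : NS r, IsLinePullback x L → ∀ s : ℝ, s = √((r : ℝ) - 1) - 3 →
      (∀ R, IsMinusOneRay x R → R ⊆ quadricCone x + ray (canonicalClass r - s • L)) ∧
      (MinusOneCurvesConjecture x →
        moriCone x ∩ nonnegHalfSpace (canonicalClass r - s • L) =
          quadricCone x ∩ nonnegHalfSpace (canonicalClass r - s • L))) ∧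
    (r = 10 →
      (∀ R, IsMinusOneRay x R → R ⊆ coneBoundary (quadricCone x + ray (canonicalClass r))) ∧
      (MinusOneCurvesConjecture x →
        moriCone x ∩ nonnegHalfSpace (canonicalClass r) =
          quadricCone x ∩ nonnegHalfSpace (canonicalClass r))) ∧
    (10 < r →
      (∀ R, IsMinusOneRay x R → Disjoint (R \ {0}) (quadricCone x + ray (canonicalClass r))) ∧
      quadricCone x ∩ nonnegHalfSpace (canonicalClass r) ⊂
        moriCone x ∩ nonnegHalfSpace (canonicalClass r)) := by
  have hr₀ : (10 : ℝ) ≤ r := mod_cast hr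
  have hKK := inter_canonicalClass_self r
  have hray (R) (hR : IsMinusOneRay x R) := hR.exists_isMinusOneClass (by lia) hx
  refine ⟨fun L hL s hs => ?_, fun h10 => ?_, fun h10 => ⟨fun R hR => ?_, ?_⟩⟩
  · have hsr : (s + 3) ^ 2 = r - 1 := by rw [hs, sub_add_cancel, Real.sq_sqrt (by linarith)]
    have hs₀ : 0 ≤ s := hs ▸ sub_nonneg.2 (Real.le_sqrt_of_sq_le (by linarith))
    have hMM := hL.inter_canonicalClass_sub_smul_self hx s
    have hM (c) (hc : IsMinusOneClass x c) := hL.sub_mem_lightCone hx hs₀ hsr.ge hc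
    refine ⟨fun R hR => ?_, moriCone_inter_nonnegHalfSpace hx (by linarith) hM⟩
    obtain ⟨c, hc, rfl⟩ := hray R hR
    exact ray_subset_quadricCone_add_ray (hM c hc)
  · have hKK' : inter (canonicalClass r) (canonicalClass r) = -1 := by rw [hKK, h10]; norm_num
    refine ⟨fun R hR => ?_, moriCone_inter_nonnegHalfSpace hx (by linarith) fun c hc => ?_⟩
    · obtain ⟨c, hc, rfl⟩ := hray R hR
      exact ray_subset_coneBoundary hc.2.1 hKK' hc.2.2 hc.fst_canonicalClass_lt
    · exact sub_mem_lightCone hc.2.1.ge hKK'.ge hc.2.2.le hc.fst_canonicalClass_lt.le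
  · obtain ⟨c, hc, rfl⟩ := hray R hR
    have hr₁ : (10 : ℝ) < r := mod_cast h10
    exact disjoint_ray_quadricCone_add_ray hc.2.1 (by linarith) hc.2.2
  · exact quadricCone_inter_ssubset_moriCone_inter h10
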